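/- **Proposition 1.1.** Let $m\ge 1$ and $k\ge 0$ be integers, and let $F$ be a real-valued $C^\infty$ function on an open neighborhood $U$ of $0$ in $\mathbb C$ such that on $U$ $$F_{z\bar z}=|z|^{2(m-1)}g,\qquad F_z=\bar z\,|z|^{2(m-1)}h,$$ where $g$ (real-valued) and $h$ (complex-valued) are continuous at $0$ and $g(0)\neq 0$. On functions of $(z,t)\in\mathbb C\times\mathbb R$ put $$L=\frac{\partial}{\partial z}+iF_z\frac{\partial}{\partial t},\qquad \bar L=\frac{\partial}{\partial\bar z}-i\,\overline{F_z}\,\frac{\partial}{\partial t},\qquad P=P^F_{m,k}=L\bar L+\bar L\,|z|^{2k}L .$$ For $s\in\mathbb R$ let $(u,v)_s=(\Lambda_t^su,\Lambda_t^sv)_{L^2(\mathbb C\times\mathbb R)}$ and $\|v\|_s^2=(v,v)_s$, with $\Lambda_t=(1-\partial_t^2)^{1/2}$, be the inner product and the norm of $L^2(z)\times H^s(t)$. Then there is $\varepsilon>0$ with $\{|z|<\varepsilon\}\subseteq U$ such that for every compact $K\subset\mathbb R$ there is a constant $C$, and for every $N\in\mathbb R$ a constant $C_N$ (depending also on $K$),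 such that $$\|v\|^2_{s-\frac{k-1}{2m}}+\|\bar Lv\|_s^2+\|\bar z^kLv\|_s^2\;\le\; C\,|(Pv,v)_s|+C_N\|v\|_{-N}^2$$ for all $s\in K$ and all $v\in C_0^\infty(\mathbb C\times\mathbb R)$ with support in $\{(z,t):|z|<\varepsilon\}$. -/

import Mathlib

open scoped ContDiff FourierTransform ComplexConjugate

noncomputable section

namespace DegenerateSquares

/-- The Wirtinger derivative `∂f/∂z = (∂f/∂x - i ∂f/∂y) / 2`. -/
def dz (f : ℂ → ℂ) (z : ℂ) : ℂ :=
  (1 / 2) * (fderiv ℝ f z 1 - Complex.I * fderiv ℝ f z Complex.I)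

/-- The Wirtinger derivative `∂f/∂z̄ = (∂f/∂x + i ∂f/∂y) / 2`. -/
def dzbar (f : ℂ → ℂ) (z : ℂ) : ℂ :=
  (1 / 2) * (fderiv ℝ f z 1 + Complex.I * fderiv ℝ f z Complex.I)

/-- `F_z` for a real-valued function `F` on the plane. -/
def Fz (F : ℂ → ℝ) : ℂ → ℂ := dz (fun z => (F z : ℂ))

/-- `F_{z z̄}` for a real-valued function `F` on the plane. -/
def Fzzbar (F : ℂ → ℝ) : ℂ → ℂ := dzbar (Fz F)

/-- The vector field `L = ∂/∂z + i F_z ∂/∂t`, acting on functions of `(z, t)`. -/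
def vecL (F : ℂ → ℝ) (v : ℂ × ℝ → ℂ) (p : ℂ × ℝ) : ℂ :=
  dz (fun z => v (z, p.2)) p.1 + Complex.I * Fz F p.1 * deriv (fun t => v (p.1, t)) p.2

/-- The complex conjugate vector field `L̄ = ∂/∂z̄ - i (F_z)‾ ∂/∂t`. -/
def vecLbar (F : ℂ → ℝ) (v : ℂ × ℝ → ℂ) (p : ℂ × ℝ) : ℂ :=
  dzbar (fun z => v (z, p.2)) p.1 - Complex.I * conj (Fz F p.1) * deriv (fun t => v (p.1, t)) p.2

/-- The operator `P = L L̄ + L̄ |z|^{2k} L`. -/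
def opP (k : ℕ) (F : ℂ → ℝ) (v : ℂ × ℝ → ℂ) (p : ℂ × ℝ) : ℂ :=
  vecL F (vecLbar F v) p + vecLbar F (fun q => ((‖q.1‖ ^ (2 * k) : ℝ) : ℂ) * vecL F v q) p

/-- The partial Fourier transform in `t`: `(z, τ) ↦ ∫ e^{-2πi tτ} v(z, t) dt`. -/
def fourierT (v : ℂ × ℝ → ℂ) (q : ℂ × ℝ) : ℂ :=
  𝓕 (fun t : ℝ => v (q.1, t)) q.2

/-- The inner product `(u, v)_s` of `L²(z) × H^s(t)`, that is `(Λ_t^s u, Λ_t^s v)_{L²}` with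
`Λ_t = (1 - ∂_t²)^{1/2}`, whose symbol is `(1 + (2πτ)²)^{1/2}`. -/
def innerS (s : ℝ) (u v : ℂ × ℝ → ℂ) : ℂ :=
  ∫ q : ℂ × ℝ, (((1 + (2 * Real.pi * q.2) ^ 2) ^ s : ℝ) : ℂ) *
    (fourierT u q * conj (fourierT v q))

/-- The norm `‖v‖_s` of `L²(z) × H^s(t)`. -/
def normS (s : ℝ) (v : ℂ × ℝ → ℂ) : ℝ :=
  √(∫ q : ℂ × ℝ, (1 + (2 * Real.pi * q.2) ^ 2) ^ s * ‖fourierT v q‖ ^ 2)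

end DegenerateSquares

end

open DegenerateSquares

/-! A partial Fourier transform in `t`, with `σ = 2πτ`, turns `L` and `L̄` into `∂_z - σ a` and
`∂_z̄ + σ ā`, where `a = F_z`. Since `-L̄` is the adjoint of `L`, the pairing `(Pv, v)_s` equals
minus the sum of the two energies `‖L̄v‖_s²` and `‖z̄ᵏLv‖_s²` (`IsTestFunction.innerS_opP`). What
remains is to bound `‖v‖` by the energy `E`, one frequency at a time.

Let `b = F_{z z̄}`, comparable to `|z|^(2(m-1))` with a fixed sign. The commutator of `L` and `L̄`
is `2σb`, so `‖Lw‖² = ‖L̄w‖² + 2σ∫b|w|²`. If `σb ≤ 0`, this bounds `|σ|∫|b||w|²` by `‖L̄w‖²`. If `σb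
≥ 0`, apply it to `z̄ᵏw`: multiplication by `z̄ᵏ` commutes with `L`, so `‖z̄ᵏLw‖²` bounds
`|σ|∫|b||z|^(2k)|w|²`. Either way `|σ|∫|z|^(2(m-1+k))|w|² ≲ E` (`weighted_le_energy`).

This weight vanishes at `0`. At the scale `δ = |σ|^(-1/(2m))` the magnetic term is harmless on `|z|
≲ δ`, and a Poincaré inequality involving `L̄` alone holds there (`poincare_sliceLbar`). Using it
inside the disc and the weight outside gives `∫|w|² ≲ δ^(2-2k) E` (`exists_slice_estimate`), and
`δ^(2-2k) = |σ|^((k-1)/m)` is the stated Sobolev loss. Frequencies `|σ| < 1` go into the error term.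
-/

namespace DegenerateSquares

open MeasureTheory

/-! ### Wirtinger calculus and integration by parts. -/

theorem dz_add {f g : ℂ → ℂ} {z : ℂ} (hf : DifferentiableAt ℝ f z) (hg : DifferentiableAt ℝ g z) :
    dz (fun z => f z + g z) z = dz f z + dz g z := by
  simp only [dz, fderiv_fun_add hf hg, add_apply]
  ring

theorem dzbar_sub {f g : ℂ → ℂ} {z : ℂ} (hf : DifferentiableAt ℝ f z)
    (hg : DifferentiableAt ℝ g z) :
    dzbar (fun z => f z - g z) z = dzbar f z - dzbar g z := by
  simp only [dzbar, fderiv_fun_sub hf hg, sub_apply]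
  ring

theorem dz_mul {f g : ℂ → ℂ} {z : ℂ} (hf : DifferentiableAt ℝ f z) (hg : DifferentiableAt ℝ g z) :
    dz (fun z => f z * g z) z = f z * dz g z + dz f z * g z := by
  simp only [dz, fderiv_fun_mul hf hg, add_apply,
    smul_apply, smul_eq_mul]
  ring

theorem dzbar_mul {f g : ℂ → ℂ} {z : ℂ} (hf : DifferentiableAt ℝ f z)
    (hg : DifferentiableAt ℝ g z) :
    dzbar (fun z => f z * g z) z = f z * dzbar g z + dzbar f z * g z := by
  simp only [dzbar, fderiv_fun_mul hf hg, add_apply,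
    smul_apply, smul_eq_mul]
  ring

theorem fderiv_conj_comp {f : ℂ → ℂ} {z : ℂ} (hf : DifferentiableAt ℝ f z) (e : ℂ) :
    fderiv ℝ (fun z => conj (f z)) z e = conj (fderiv ℝ f z e) := by
  have h : HasFDerivAt (fun z => conj (f z))
      ((Complex.conjCLE : ℂ →L[ℝ] ℂ).comp (fderiv ℝ f z)) z :=
    (Complex.conjCLE : ℂ →L[ℝ] ℂ).hasFDerivAt.comp z hf.hasFDerivAt
  rw [h.fderiv]
  simp

theorem dz_conj {f : ℂ → ℂ} {z : ℂ} (hf : DifferentiableAt ℝ f z) :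
    dz (fun z => conj (f z)) z = conj (dzbar f z) := by
  simp [dz, dzbar, fderiv_conj_comp hf, sub_eq_add_neg, map_ofNat]

theorem dzbar_conj {f : ℂ → ℂ} {z : ℂ} (hf : DifferentiableAt ℝ f z) :
    dzbar (fun z => conj (f z)) z = conj (dz f z) := by
  simp [dz, dzbar, fderiv_conj_comp hf, sub_eq_add_neg, map_ofNat]

theorem dzbar_id (z : ℂ) : dzbar (fun z => z) z = 0 := by
  simp [dzbar]

theorem dz_id (z : ℂ) : dz (fun z => z) z = 1 := by
  simp [dz]; norm_num

theorem dz_const_mul {f : ℂ → ℂ} {z : ℂ} (c : ℂ) (hf : DifferentiableAt ℝ f z) :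
    dz (fun z => c * f z) z = c * dz f z := by
  rw [dz_mul (by fun_prop) hf]
  simp [dz]

theorem dzbar_const_mul {f : ℂ → ℂ} {z : ℂ} (c : ℂ) (hf : DifferentiableAt ℝ f z) :
    dzbar (fun z => c * f z) z = c * dzbar f z := by
  rw [dzbar_mul (by fun_prop) hf]
  simp [dzbar]

theorem contDiff_conj {f : ℂ → ℂ} (hf : ContDiff ℝ ∞ f) : ContDiff ℝ ∞ (fun z => conj (f z)) :=
  (Complex.conjCLE : ℂ →L[ℝ] ℂ).contDiff.comp hf

theorem contDiff_fderiv_apply {E : Type*} [NormedAddCommGroup E] [NormedSpace ℝ E] {f : E → ℂ}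
    (hf : ContDiff ℝ ∞ f) (e : E) : ContDiff ℝ ∞ (fun z => fderiv ℝ f z e) :=
  (hf.fderiv_right (m := ∞) (by simp)).clm_apply contDiff_const

theorem contDiff_dz {f : ℂ → ℂ} (hf : ContDiff ℝ ∞ f) : ContDiff ℝ ∞ (dz f) := by
  have h1 := contDiff_fderiv_apply hf 1
  have h2 := contDiff_fderiv_apply hf Complex.I
  unfold dz
  fun_prop

theorem contDiff_dzbar {f : ℂ → ℂ} (hf : ContDiff ℝ ∞ f) : ContDiff ℝ ∞ (dzbar f) := by
  have h1 := contDiff_fderiv_apply hf 1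
  have h2 := contDiff_fderiv_apply hf Complex.I
  unfold dzbar
  fun_prop

theorem dz_eq_zero_of_notMem {f : ℂ → ℂ} {z : ℂ} (hz : z ∉ tsupport f) : dz f z = 0 := by
  simp [dz, fderiv_of_notMem_tsupport ℝ hz]

theorem dzbar_eq_zero_of_notMem {f : ℂ → ℂ} {z : ℂ} (hz : z ∉ tsupport f) : dzbar f z = 0 := by
  simp [dzbar, fderiv_of_notMem_tsupport ℝ hz]

/-- The Wirtinger derivatives of a smooth function commute. -/
theorem dz_dzbar_comm {f : ℂ → ℂ} (hf : ContDiff ℝ ∞ f) (z : ℂ) :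
    dz (dzbar f) z = dzbar (dz f) z := by
  have hd : DifferentiableAt ℝ (fderiv ℝ f) z :=
    ((hf.fderiv_right (m := ∞) (by simp)).differentiable (by simp)) z
  have key : ∀ e d : ℂ, fderiv ℝ (fun z => fderiv ℝ f z e) z d = fderiv ℝ (fderiv ℝ f) z d e := by
    intro e d
    rw [fderiv_clm_apply hd (by fun_prop)]
    simp
  have hdd : ∀ e : ℂ, DifferentiableAt ℝ (fun z => fderiv ℝ f z e) z := fun e =>
    ((contDiff_fderiv_apply hf e).differentiable (by simp)) z
  have hsymm : IsSymmSndFDerivAt ℝ f z :=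
    hf.contDiffAt.isSymmSndFDerivAt (by
      rw [minSmoothness_of_isRCLikeNormedField]
      exact WithTop.coe_le_coe.2 le_top)
  have e1 : ∀ c : ℂ, ∀ d : ℂ, fderiv ℝ (fun z => (1 / 2 : ℂ) * (fderiv ℝ f z 1 +
      c * fderiv ℝ f z Complex.I)) z d =
      (1 / 2 : ℂ) * (fderiv ℝ (fderiv ℝ f) z d 1 + c * fderiv ℝ (fderiv ℝ f) z d Complex.I) := by
    intro c d
    have h1 := hdd 1
    have h2 := hdd Complex.I
    rw [fderiv_const_mul (by fun_prop), smul_apply,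
      fderiv_fun_add h1 (by fun_prop), add_apply, fderiv_const_mul h2,
      smul_apply, key, key]
    simp
  have e2 : dzbar f = fun z => (1 / 2 : ℂ) * (fderiv ℝ f z 1 +
      Complex.I * fderiv ℝ f z Complex.I) := rfl
  have e3 : dz f = fun z => (1 / 2 : ℂ) * (fderiv ℝ f z 1 +
      (-Complex.I) * fderiv ℝ f z Complex.I) := by
    funext z; simp only [dz]; ring
  rw [e2, e3]
  simp only [dz, dzbar]
  rw [e1, e1, e1, e1, hsymm.eq 1 Complex.I]
  ring

/-- Integration by parts for `∂/∂z`. -/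
theorem integral_dz_mul {f g : ℂ → ℂ} (hf : ContDiff ℝ ∞ f) (hg : ContDiff ℝ ∞ g)
    (hc : HasCompactSupport g) : ∫ z, dz f z * g z = -∫ z, f z * dz g z := by
  have key : ∀ e : ℂ, ∫ z, f z * fderiv ℝ g z e = -∫ z, fderiv ℝ f z e * g z := by
    intro e
    refine integral_mul_fderiv_eq_neg_fderiv_mul_of_integrable ?_ ?_ ?_
      (fun z _ => hf.differentiable (by simp) z) (fun z _ => hg.differentiable (by simp) z)
    · exact ((contDiff_fderiv_apply hf e).continuous.mul
        hg.continuous).integrable_of_hasCompactSupport hc.mul_left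
    · exact (hf.continuous.mul
        (contDiff_fderiv_apply hg e).continuous).integrable_of_hasCompactSupport
        (hc.fderiv_apply (𝕜 := ℝ) e).mul_left
    · exact (hf.continuous.mul hg.continuous).integrable_of_hasCompactSupport hc.mul_left
  have i1 : ∀ e : ℂ, Integrable (fun z => fderiv ℝ f z e * g z) := fun e =>
    ((contDiff_fderiv_apply hf e).continuous.mul hg.continuous).integrable_of_hasCompactSupport
        hc.mul_left
  have i2 : ∀ e : ℂ, Integrable (fun z => f z * fderiv ℝ g z e) := fun e =>
    (hf.continuous.mul (contDiff_fderiv_apply hg e).continuous).integrable_of_hasCompactSupport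
        (hc.fderiv_apply (𝕜 := ℝ) e).mul_left
  have e1 : (fun z => dz f z * g z) = fun z => (1 / 2 : ℂ) * (fderiv ℝ f z 1 * g z) -
      (Complex.I / 2) * (fderiv ℝ f z Complex.I * g z) := by
    funext z; simp only [dz]; ring
  have e2 : (fun z => f z * dz g z) = fun z => (1 / 2 : ℂ) * (f z * fderiv ℝ g z 1) -
      (Complex.I / 2) * (f z * fderiv ℝ g z Complex.I) := by
    funext z; simp only [dz]; ring
  rw [e1, e2, integral_sub ((i1 _).const_mul _) ((i1 _).const_mul _),
    integral_sub ((i2 _).const_mul _) ((i2 _).const_mul _)]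
  simp only [integral_const_mul, key]
  ring

/-! ### The operators at a fixed frequency: adjoints and commutator. -/

/-- The operator `∂/∂z - σ a`, the image of `L` under the partial Fourier transform. -/
noncomputable def sliceL (a : ℂ → ℂ) (σ : ℝ) (w : ℂ → ℂ) (z : ℂ) : ℂ := dz w z - σ * a z * w z

/-- The operator `∂/∂z̄ + σ ā`, the image of `L̄` under the partial Fourier transform. -/
noncomputable def sliceLbar (a : ℂ → ℂ) (σ : ℝ) (w : ℂ → ℂ) (z : ℂ) : ℂ :=
  dzbar w z + σ * conj (a z) * w z

theorem contDiff_sliceL {a w : ℂ → ℂ} (ha : ContDiff ℝ ∞ a) (hw : ContDiff ℝ ∞ w) (σ : ℝ) :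
    ContDiff ℝ ∞ (sliceL a σ w) := by
  have := contDiff_dz hw
  unfold sliceL
  fun_prop

theorem contDiff_sliceLbar {a w : ℂ → ℂ} (ha : ContDiff ℝ ∞ a) (hw : ContDiff ℝ ∞ w) (σ : ℝ) :
    ContDiff ℝ ∞ (sliceLbar a σ w) := by
  have := contDiff_dzbar hw
  have := contDiff_conj ha
  unfold sliceLbar
  fun_prop

theorem sliceL_eq_zero {a w : ℂ → ℂ} {z : ℂ} (σ : ℝ) (hz : z ∉ tsupport w) :
    sliceL a σ w z = 0 := by
  simp [sliceL, dz_eq_zero_of_notMem hz, image_eq_zero_of_notMem_tsupport hz]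

theorem sliceLbar_eq_zero {a w : ℂ → ℂ} {z : ℂ} (σ : ℝ) (hz : z ∉ tsupport w) :
    sliceLbar a σ w z = 0 := by
  simp [sliceLbar, dzbar_eq_zero_of_notMem hz, image_eq_zero_of_notMem_tsupport hz]

theorem hasCompactSupport_sliceL {a w : ℂ → ℂ} (σ : ℝ) (hw : HasCompactSupport w) :
    HasCompactSupport (sliceL a σ w) :=
  HasCompactSupport.intro hw fun _ hz => sliceL_eq_zero σ hz

theorem hasCompactSupport_sliceLbar {a w : ℂ → ℂ} (σ : ℝ) (hw : HasCompactSupport w) :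
    HasCompactSupport (sliceLbar a σ w) :=
  HasCompactSupport.intro hw fun _ hz => sliceLbar_eq_zero σ hz

theorem hasCompactSupport_conj {f : ℂ → ℂ} (hf : HasCompactSupport f) :
    HasCompactSupport (fun z => conj (f z)) :=
  hf.comp_left (g := fun z : ℂ => conj z) (by simp)

/-- `-L̄` is the formal adjoint of `L`. -/
theorem integral_sliceL_mul_conj {a f g : ℂ → ℂ} (ha : ContDiff ℝ ∞ a) (hf : ContDiff ℝ ∞ f)
    (hg : ContDiff ℝ ∞ g) (hc : HasCompactSupport g) (σ : ℝ) :
    ∫ z, sliceL a σ f z * conj (g z) = -∫ z, f z * conj (sliceLbar a σ g z) := by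
  have hcg := hasCompactSupport_conj hc
  have hg' := contDiff_conj hg
  have e1 : (fun z => sliceL a σ f z * conj (g z)) = fun z => dz f z * conj (g z) -
      (σ * a z * f z) * conj (g z) := by
    funext z; simp only [sliceL]; ring
  have e2 : (fun z => f z * conj (sliceLbar a σ g z)) = fun z => f z * dz (fun z => conj (g z)) z +
      (σ * a z * f z) * conj (g z) := by
    funext z
    rw [dz_conj (hg.differentiable (by simp) z)]
    simp only [sliceLbar, map_add, map_mul, Complex.conj_conj, Complex.conj_ofReal]; ring
  have i1 : Integrable (fun z => dz f z * conj (g z)) :=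
    ((contDiff_dz hf).continuous.mul hg'.continuous).integrable_of_hasCompactSupport hcg.mul_left
  have i2 : Integrable (fun z => (σ * a z * f z) * conj (g z)) := by
    have h1 := ha.continuous
    have h2 := hf.continuous
    have h3 := hg'.continuous
    exact Continuous.integrable_of_hasCompactSupport (by fun_prop) hcg.mul_left
  have i3 : Integrable (fun z => f z * dz (fun z => conj (g z)) z) :=
    (hf.continuous.mul (contDiff_dz hg').continuous).integrable_of_hasCompactSupport
      (HasCompactSupport.mul_left (HasCompactSupport.intro hcg
        fun z hz => dz_eq_zero_of_notMem hz))
  rw [e1, e2, integral_sub i1 i2, integral_add i3 i2, integral_dz_mul hf hg' hcg]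
  ring

theorem integral_sliceLbar_mul_conj {a f g : ℂ → ℂ} (ha : ContDiff ℝ ∞ a) (hf : ContDiff ℝ ∞ f)
    (hg : ContDiff ℝ ∞ g) (hc : HasCompactSupport f) (σ : ℝ) :
    ∫ z, sliceLbar a σ f z * conj (g z) = -∫ z, f z * conj (sliceL a σ g z) := by
  have h := congrArg conj (integral_sliceL_mul_conj ha hg hf hc σ)
  rw [map_neg, ← integral_conj, ← integral_conj] at h
  simp only [map_mul, Complex.conj_conj] at h
  simp only [mul_comm (sliceLbar a σ f _), mul_comm (f _), h, neg_neg]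

theorem integral_mul_conj_self (f : ℂ → ℂ) :
    ∫ z, f z * conj (f z) = ((∫ z, ‖f z‖ ^ 2 : ℝ) : ℂ) := by
  rw [← integral_complex_ofReal]
  simp [Complex.mul_conj']

/-- The second-order and first-order terms cancel, leaving `σ(∂_z ā + ∂_z̄ a)w`. As `∂_z ā` is the
conjugate of `∂_z̄ a`, reality of `b` makes the two contributions equal. -/
theorem sliceL_sliceLbar_sub {a w b : ℂ → ℂ} (ha : ContDiff ℝ ∞ a) (hw : ContDiff ℝ ∞ w) (σ : ℝ)
    (z : ℂ) (hb : dzbar a z = b z) (hbr : conj (b z) = b z) :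
    sliceL a σ (sliceLbar a σ w) z - sliceLbar a σ (sliceL a σ w) z = 2 * σ * b z * w z := by
  have hwd : DifferentiableAt ℝ w z := hw.differentiable (by simp) z
  have had : DifferentiableAt ℝ a z := ha.differentiable (by simp) z
  have hac : DifferentiableAt ℝ (fun z => conj (a z)) z :=
    (contDiff_conj ha).differentiable (by simp) z
  have h1 : DifferentiableAt ℝ (dz w) z := (contDiff_dz hw).differentiable (by simp) z
  have h2 : DifferentiableAt ℝ (dzbar w) z := (contDiff_dzbar hw).differentiable (by simp) z
  have e1 : dz (sliceLbar a σ w) z = dz (dzbar w) z +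
      σ * (conj (a z) * dz w z + b z * w z) := by
    have : sliceLbar a σ w = fun z => dzbar w z + σ * (conj (a z) * w z) := by
      funext z; simp only [sliceLbar]; ring
    rw [this, dz_add h2 (by fun_prop), dz_const_mul _ (by fun_prop), dz_mul hac hwd, dz_conj had,
      hb, hbr]
  have e2 : dzbar (sliceL a σ w) z = dzbar (dz w) z - σ * (a z * dzbar w z + b z * w z) := by
    have : sliceL a σ w = fun z => dz w z - σ * (a z * w z) := by
      funext z; simp only [sliceL]; ring
    rw [this, dzbar_sub h1 (by fun_prop), dzbar_const_mul _ (by fun_prop), dzbar_mul had hwd, hb]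
  rw [sliceL, sliceLbar.eq_def a σ (sliceL a σ w), e1, e2, dz_dzbar_comm hw]
  simp only [sliceL, sliceLbar]
  ring

/-- The basic identity `‖Lw‖² = ‖L̄w‖² + 2σ ∫ a_{z̄} |w|²`. -/
theorem integral_norm_sliceL_sq {a w : ℂ → ℂ} {b : ℂ → ℝ} (ha : ContDiff ℝ ∞ a)
    (hw : ContDiff ℝ ∞ w) (hc : HasCompactSupport w) (σ : ℝ)
    (hb : ∀ z ∈ tsupport w, dzbar a z = b z) :
    ∫ z, ‖sliceL a σ w z‖ ^ 2 =
      (∫ z, ‖sliceLbar a σ w z‖ ^ 2) + 2 * σ * ∫ z, b z * ‖w z‖ ^ 2 := by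
  have hL := contDiff_sliceL ha hw σ
  have hLb := contDiff_sliceLbar ha hw σ
  -- Both energies become pairings of `w` with second-order operators applied to `w`, so their
  -- difference is a pairing with the commutator.
  have e1 := integral_sliceL_mul_conj ha hw hL (hasCompactSupport_sliceL σ hc) σ
  have e2 := integral_sliceLbar_mul_conj ha hw hLb hc σ
  rw [integral_mul_conj_self] at e1 e2
  have i1 : Integrable (fun z => w z * conj (sliceLbar a σ (sliceL a σ w) z)) :=
    (hw.continuous.mul (contDiff_conj (contDiff_sliceLbar ha hL σ)).continuous)
      |>.integrable_of_hasCompactSupport hc.mul_right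
  have i2 : Integrable (fun z => w z * conj (sliceL a σ (sliceLbar a σ w) z)) :=
    (hw.continuous.mul (contDiff_conj (contDiff_sliceL ha hLb σ)).continuous)
      |>.integrable_of_hasCompactSupport hc.mul_right
  have e3 : ((∫ z, ‖sliceL a σ w z‖ ^ 2 : ℝ) : ℂ) - ((∫ z, ‖sliceLbar a σ w z‖ ^ 2 : ℝ) : ℂ) =
      ((2 * σ * ∫ z, b z * ‖w z‖ ^ 2 : ℝ) : ℂ) := by
    rw [e1, e2, neg_sub_neg, ← integral_sub i2 i1, ← integral_const_mul, ← integral_complex_ofReal]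
    congr 1
    funext z
    by_cases hz : z ∈ tsupport w
    · rw [← mul_sub, ← map_sub, sliceL_sliceLbar_sub (b := fun z => b z) ha hw σ z (hb z hz)
        (by simp)]
      simp only [map_mul, Complex.conj_ofReal, Complex.ofReal_mul, Complex.ofReal_pow,
        ← Complex.mul_conj', map_ofNat, Complex.ofReal_ofNat]
      ring
    · simp [image_eq_zero_of_notMem_tsupport hz]
  have e4 := Complex.ofReal_injective ((Complex.ofReal_sub _ _).trans e3)
  linarith

/-! ### Weighted and Poincaré inequalities at a fixed frequency. -/

theorem sliceL_mul {a f w : ℂ → ℂ} {z : ℂ} (σ : ℝ) (hf : DifferentiableAt ℝ f z)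
    (hw : DifferentiableAt ℝ w z) :
    sliceL a σ (fun z => f z * w z) z = f z * sliceL a σ w z + dz f z * w z := by
  simp only [sliceL, dz_mul hf hw]
  ring

theorem sliceLbar_mul {a f w : ℂ → ℂ} {z : ℂ} (σ : ℝ) (hf : DifferentiableAt ℝ f z)
    (hw : DifferentiableAt ℝ w z) :
    sliceLbar a σ (fun z => f z * w z) z = f z * sliceLbar a σ w z + dzbar f z * w z := by
  simp only [sliceLbar, dzbar_mul hf hw]
  ring

theorem contDiff_conj_pow (k : ℕ) : ContDiff ℝ ∞ (fun z : ℂ => conj z ^ k) :=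
  (contDiff_conj contDiff_id).pow k

/-- Antiholomorphy of `z̄ᵏ` is what lets `L` commute with multiplication by it; this is used when
`σb ≥ 0`. -/
theorem dz_conj_pow (k : ℕ) (z : ℂ) : dz (fun z => conj z ^ k) z = 0 := by
  have hd : DifferentiableAt ℝ (fun z : ℂ => conj z) z :=
    (contDiff_conj contDiff_id).differentiable (by simp) z
  induction k with
  | zero => simp [dz]
  | succ k ih =>
    simp only [pow_succ]
    rw [dz_mul (f := fun z => conj z ^ k) (hd.pow k) hd, ih,
      dz_conj differentiableAt_fun_id, dzbar_id]
    simp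

theorem integrable_norm_sq {f : ℂ → ℂ} (hf : Continuous f) (hc : HasCompactSupport f) :
    Integrable (fun z => ‖f z‖ ^ 2) := by
  have h1 : Continuous (fun z => ‖f z‖ ^ 2) := by fun_prop
  refine h1.integrable_of_hasCompactSupport (HasCompactSupport.intro hc fun z hz => ?_)
  simp [image_eq_zero_of_notMem_tsupport hz]

theorem integrable_mul_norm_sq {f : ℂ → ℂ} {p : ℂ → ℝ} (hp : Continuous p) (hf : Continuous f)
    (hc : HasCompactSupport f) : Integrable (fun z => p z * ‖f z‖ ^ 2) := by
  have h1 : Continuous (fun z => p z * ‖f z‖ ^ 2) := by fun_prop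
  refine h1.integrable_of_hasCompactSupport (HasCompactSupport.intro hc fun z hz => ?_)
  simp [image_eq_zero_of_notMem_tsupport hz]

theorem integrable_mul_norm_sq_of_eqOn {f : ℂ → ℂ} {b : ℂ → ℝ} {p : ℂ → ℝ} (hp : Continuous p)
    (hf : Continuous f) (hc : HasCompactSupport f) (hb : ∀ z ∈ tsupport f, b z = p z) :
    Integrable (fun z => b z * ‖f z‖ ^ 2) := by
  refine (integrable_mul_norm_sq hp hf hc).congr (Filter.Eventually.of_forall fun z => ?_)
  by_cases hz : z ∈ tsupport f
  · simp [hb z hz]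
  · simp [image_eq_zero_of_notMem_tsupport hz]

/-- Off the support `b` is arbitrary, so integrability is inherited from the continuous function `Re
∂_z̄ a`. -/
theorem integrable_levi_mul_norm_sq {a f : ℂ → ℂ} {b : ℂ → ℝ} (ha : ContDiff ℝ ∞ a)
    (hf : Continuous f) (hc : HasCompactSupport f) (hb : ∀ z ∈ tsupport f, dzbar a z = b z) :
    Integrable (fun z => b z * ‖f z‖ ^ 2) :=
  integrable_mul_norm_sq_of_eqOn (p := fun z => (dzbar a z).re)
    (Complex.continuous_re.comp (contDiff_dzbar ha).continuous) hf hc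
    fun z hz => by simp [hb z hz]

/-- The degenerate weighted estimate, valid for either sign of `σ`. -/
theorem weighted_le_energy {m k : ℕ} {c s₀ : ℝ} (hs₀ : s₀ = 1 ∨ s₀ = -1) (hc0 : 0 ≤ c)
    {a w : ℂ → ℂ} {b : ℂ → ℝ} (ha : ContDiff ℝ ∞ a)
    (hw : ContDiff ℝ ∞ w) (hc : HasCompactSupport w) (hw1 : ∀ z ∈ tsupport w, ‖z‖ ≤ 1)
    (hb : ∀ z ∈ tsupport w, dzbar a z = b z)
    (hlow : ∀ z ∈ tsupport w, c * ‖z‖ ^ (2 * (m - 1)) ≤ s₀ * b z) (σ : ℝ) :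
    2 * c * |σ| * ∫ z, ‖z‖ ^ (2 * (m - 1 + k)) * ‖w z‖ ^ 2 ≤
      (∫ z, ‖sliceLbar a σ w z‖ ^ 2) + ∫ z, ‖conj z ^ k * sliceL a σ w z‖ ^ 2 := by
  have hwc := hw.continuous
  have hint := integrable_mul_norm_sq (p := fun z => ‖z‖ ^ (2 * (m - 1 + k))) (by fun_prop) hwc hc
  have hsign : σ = |σ| * s₀ ∨ σ = -(|σ| * s₀) := by
    rcases hs₀ with rfl | rfl <;> rcases abs_cases σ with ⟨h, -⟩ | ⟨h, -⟩ <;> rw [h] <;> simp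
  have n1 : 0 ≤ ∫ z, ‖sliceLbar a σ w z‖ ^ 2 := integral_nonneg fun z => by positivity
  have n2 : 0 ≤ ∫ z, ‖conj z ^ k * sliceL a σ w z‖ ^ 2 := integral_nonneg fun z => by positivity
  have hss : s₀ * s₀ = 1 := by rcases hs₀ with rfl | rfl <;> norm_num
  rcases hsign with hσ | hσ
  -- Here `σb ≥ 0` on the support: the commutator identity for `z̄ᵏw` bounds `‖z̄ᵏLw‖²` from below,
  -- and `‖L̄(z̄ᵏw)‖²` is dropped.
  · have hu : ContDiff ℝ ∞ (fun z => conj z ^ k * w z) := (contDiff_conj_pow k).mul hw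
    have huc : HasCompactSupport (fun z => conj z ^ k * w z) := hc.mul_left
    have hsub : tsupport (fun z => conj z ^ k * w z) ⊆ tsupport w := tsupport_mul_subset_right
    have key := integral_norm_sliceL_sq ha hu huc σ fun z hz => hb z (hsub hz)
    have e1 : ∀ z, sliceL a σ (fun z => conj z ^ k * w z) z = conj z ^ k * sliceL a σ w z := by
      intro z
      rw [sliceL_mul σ ((contDiff_conj_pow k).differentiable (by simp) z)
        (hw.differentiable (by simp) z), dz_conj_pow]
      simp
    simp only [e1] at key
    have n3 : 0 ≤ ∫ z, ‖sliceLbar a σ (fun z => conj z ^ k * w z) z‖ ^ 2 :=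
      integral_nonneg fun z => by positivity
    have hmono : c * ∫ z, ‖z‖ ^ (2 * (m - 1 + k)) * ‖w z‖ ^ 2 ≤
        s₀ * ∫ z, b z * ‖conj z ^ k * w z‖ ^ 2 := by
      rw [← integral_const_mul, ← integral_const_mul]
      have i1 := (integrable_levi_mul_norm_sq ha hu.continuous huc
        fun z hz => hb z (hsub hz)).const_mul s₀
      refine integral_mono (hint.const_mul c) i1 fun z => ?_
      by_cases hz : z ∈ tsupport w
      · have := mul_le_mul_of_nonneg_right (hlow z hz)
          (show 0 ≤ ‖conj z ^ k * w z‖ ^ 2 by positivity)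
        refine le_trans (le_of_eq ?_) (this.trans (le_of_eq (by ring)))
        simp only [norm_mul, norm_pow, RCLike.norm_conj]
        ring
      · simp [image_eq_zero_of_notMem_tsupport hz]
    have h2 : 2 * σ * (∫ z, b z * ‖conj z ^ k * w z‖ ^ 2) =
        2 * |σ| * (s₀ * ∫ z, b z * ‖conj z ^ k * w z‖ ^ 2) := by
      nth_rewrite 1 [hσ]; ring
    have := mul_le_mul_of_nonneg_left hmono (show 0 ≤ 2 * |σ| by positivity)
    linarith
  -- Here `σb ≤ 0`: the identity for `w` itself bounds `‖L̄w‖²` from below, with a weight that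
  -- dominates the required one because `|z| ≤ 1`.
  · have key := integral_norm_sliceL_sq ha hw hc σ hb
    have n3 : 0 ≤ ∫ z, ‖sliceL a σ w z‖ ^ 2 := integral_nonneg fun z => by positivity
    have hmono : c * ∫ z, ‖z‖ ^ (2 * (m - 1 + k)) * ‖w z‖ ^ 2 ≤
        s₀ * ∫ z, b z * ‖w z‖ ^ 2 := by
      rw [← integral_const_mul, ← integral_const_mul]
      have i1 := (integrable_levi_mul_norm_sq ha hwc hc hb).const_mul s₀
      refine integral_mono (hint.const_mul c) i1 fun z => ?_
      by_cases hz : z ∈ tsupport w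
      · have h1 : ‖z‖ ^ (2 * (m - 1 + k)) ≤ ‖z‖ ^ (2 * (m - 1)) :=
          pow_le_pow_of_le_one (norm_nonneg _) (hw1 z hz) (by omega)
        have h2 := (mul_le_mul_of_nonneg_left h1 hc0).trans (hlow z hz)
        have := mul_le_mul_of_nonneg_right h2 (show 0 ≤ ‖w z‖ ^ 2 by positivity)
        linarith
      · simp [image_eq_zero_of_notMem_tsupport hz]
    have h2 : 2 * σ * (∫ z, b z * ‖w z‖ ^ 2) = -(2 * |σ| * (s₀ * ∫ z, b z * ‖w z‖ ^ 2)) := by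
      nth_rewrite 1 [hσ]; ring
    have := mul_le_mul_of_nonneg_left hmono (show 0 ≤ 2 * |σ| by positivity)
    linarith

/-- A Poincaré inequality at the scale where the magnetic term is small. -/
theorem poincare_sliceLbar {a u : ℂ → ℂ} {b : ℂ → ℝ} (ha : ContDiff ℝ ∞ a)
    (hu : ContDiff ℝ ∞ u) (hc : HasCompactSupport u)
    (hb : ∀ z ∈ tsupport u, dzbar a z = b z) {ρ B σ : ℝ}
    (hρ : ∀ z ∈ tsupport u, ‖z‖ ≤ ρ) (hB : ∀ z ∈ tsupport u, |b z| ≤ B)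
    (hsmall : 8 * ρ ^ 2 * (|σ| * B) ≤ 1) :
    ∫ z, ‖u z‖ ^ 2 ≤ 8 * ρ ^ 2 * ∫ z, ‖sliceLbar a σ u z‖ ^ 2 := by
  have hL := contDiff_sliceL ha hu σ
  have hLb := contDiff_sliceLbar ha hu σ
  have iu := integrable_norm_sq hu.continuous hc
  have iL := integrable_norm_sq hL.continuous (hasCompactSupport_sliceL σ hc)
  have iLb := integrable_norm_sq hLb.continuous (hasCompactSupport_sliceLbar σ hc)
  have hconj : ContDiff ℝ ∞ (fun z : ℂ => conj z) := contDiff_conj contDiff_id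
  have hzu : ContDiff ℝ ∞ (fun z => conj z * u z) := hconj.mul hu
  -- Since `[L̄, z̄] = 1`, pairing `L̄(z̄u)` with `u` produces `∫|u|²`, and the other terms carry a
  -- factor `|z| ≤ ρ`.
  have key := integral_sliceLbar_mul_conj (g := u) ha hzu hu hc.mul_left σ
  have e1 : ∀ z, sliceLbar a σ (fun z => conj z * u z) z = conj z * sliceLbar a σ u z + u z := by
    intro z
    rw [sliceLbar_mul σ (hconj.differentiable (by simp) z) (hu.differentiable (by simp) z),
      dzbar_conj differentiableAt_fun_id, dz_id]
    simp
  simp only [e1, add_mul] at key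
  have j1 : Integrable (fun z => conj z * sliceLbar a σ u z * conj (u z)) :=
    Continuous.integrable_of_hasCompactSupport
      ((hconj.continuous.mul hLb.continuous).mul (contDiff_conj hu).continuous)
      (hasCompactSupport_conj hc).mul_left
  have j2 : Integrable (fun z => u z * conj (u z)) :=
    Continuous.integrable_of_hasCompactSupport
      (hu.continuous.mul (contDiff_conj hu).continuous) hc.mul_right
  have j3 : Integrable (fun z => conj z * u z * conj (sliceL a σ u z)) :=
    Continuous.integrable_of_hasCompactSupport
      (hzu.continuous.mul (contDiff_conj hL).continuous) (hc.mul_left.mul_right)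
  rw [integral_add j1 j2, integral_mul_conj_self] at key
  have e2 : ((∫ z, ‖u z‖ ^ 2 : ℝ) : ℂ) = -∫ z, (conj z * sliceLbar a σ u z * conj (u z) +
      conj z * u z * conj (sliceL a σ u z)) := by
    rw [integral_add j1 j3, ← sub_eq_zero]
    linear_combination key
  have hpt : ∀ z, ‖conj z * sliceLbar a σ u z * conj (u z) +
      conj z * u z * conj (sliceL a σ u z)‖ ≤
      (1 / 2) * ‖u z‖ ^ 2 + ρ ^ 2 * (‖sliceLbar a σ u z‖ ^ 2 + ‖sliceL a σ u z‖ ^ 2) := by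
    intro z
    by_cases hz : z ∈ tsupport u
    · refine (norm_add_le _ _).trans ?_
      simp only [norm_mul, RCLike.norm_conj]
      have h0 := hρ z hz
      set x := ‖sliceLbar a σ u z‖
      set y := ‖sliceL a σ u z‖
      have hx : 0 ≤ x := norm_nonneg _
      have hy : 0 ≤ y := norm_nonneg _
      have hn := norm_nonneg (u z)
      have h1 : ‖z‖ * x * ‖u z‖ ≤ ρ * x * ‖u z‖ := by gcongr
      have h2 : ‖z‖ * ‖u z‖ * y ≤ ρ * ‖u z‖ * y := by gcongr
      nlinarith [sq_nonneg (‖u z‖ / 2 - ρ * x), sq_nonneg (‖u z‖ / 2 - ρ * y)]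
    · simp [image_eq_zero_of_notMem_tsupport hz, sliceL_eq_zero σ hz, sliceLbar_eq_zero σ hz]
  have e3 : ∫ z, ‖u z‖ ^ 2 ≤ (1 / 2) * (∫ z, ‖u z‖ ^ 2) +
      ρ ^ 2 * ((∫ z, ‖sliceLbar a σ u z‖ ^ 2) + ∫ z, ‖sliceL a σ u z‖ ^ 2) := by
    have n0 : 0 ≤ ∫ z, ‖u z‖ ^ 2 := integral_nonneg fun z => by positivity
    calc ∫ z, ‖u z‖ ^ 2 = ‖((∫ z, ‖u z‖ ^ 2 : ℝ) : ℂ)‖ := by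
          rw [Complex.norm_real, Real.norm_of_nonneg n0]
      _ ≤ ∫ z, ((1 / 2) * ‖u z‖ ^ 2 +
          ρ ^ 2 * (‖sliceLbar a σ u z‖ ^ 2 + ‖sliceL a σ u z‖ ^ 2)) := by
          rw [e2, norm_neg]
          exact norm_integral_le_of_norm_le ((iu.const_mul _).add ((iLb.add iL).const_mul _))
            (Filter.Eventually.of_forall hpt)
      _ = _ := by
          have i1 : Integrable (fun z => ‖sliceLbar a σ u z‖ ^ 2 + ‖sliceL a σ u z‖ ^ 2) :=
            iLb.add iL
          rw [integral_add (iu.const_mul _) (i1.const_mul _), integral_const_mul,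
            integral_const_mul, integral_add iLb iL]
  -- `‖Lu‖²` is not controlled by the degenerate energy, so it is traded for `‖L̄u‖²`; the smallness
  -- hypothesis absorbs the commutator.
  have e4 := integral_norm_sliceL_sq ha hu hc σ hb
  have e5 : σ * ∫ z, b z * ‖u z‖ ^ 2 ≤ |σ| * B * ∫ z, ‖u z‖ ^ 2 := by
    rw [← integral_const_mul, ← integral_const_mul]
    refine integral_mono ((integrable_levi_mul_norm_sq ha hu.continuous hc hb).const_mul _)
      (iu.const_mul _) fun z => ?_
    by_cases hz : z ∈ tsupport u
    · have h1 : σ * b z ≤ |σ| * B := (le_abs_self _).trans (by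
        rw [abs_mul]; exact mul_le_mul_of_nonneg_left (hB z hz) (abs_nonneg _))
      have := mul_le_mul_of_nonneg_right h1 (show 0 ≤ ‖u z‖ ^ 2 by positivity)
      linarith
    · simp [image_eq_zero_of_notMem_tsupport hz]
  have n0 : 0 ≤ ∫ z, ‖u z‖ ^ 2 := integral_nonneg fun z => by positivity
  have h1 := mul_le_mul_of_nonneg_left e5 (sq_nonneg ρ)
  have h2 := mul_le_mul_of_nonneg_right hsmall n0
  rw [e4] at e3
  nlinarith

/-! ### Cutoffs and the estimate at the critical scale. -/

/-- Smooth cutoffs at every scale, with uniformly controlled first derivatives. -/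
theorem exists_cutoff : ∃ M : ℝ, 0 ≤ M ∧ ∀ r : ℝ, 0 < r → ∃ χ : ℂ → ℂ, ContDiff ℝ ∞ χ ∧
    (∀ z, ‖χ z‖ ≤ 1) ∧ (∀ z, ‖z‖ < r → χ z = 1) ∧ (∀ z ∈ tsupport χ, ‖z‖ ≤ 2 * r) ∧
    (∀ z, ‖dzbar χ z‖ ≤ M / r) ∧ ∀ z, ‖z‖ < r → dzbar χ z = 0 := by
  let β : ContDiffBump (0 : ℂ) := ⟨1, 2, one_pos, one_lt_two⟩
  have hφ : ContDiff ℝ ∞ (fun z => (β z : ℂ)) := Complex.ofRealCLM.contDiff.comp β.contDiff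
  have hφc : HasCompactSupport (fun z => (β z : ℂ)) :=
    β.hasCompactSupport.comp_left (g := fun x : ℝ => (x : ℂ)) (by simp)
  have hdc : HasCompactSupport (dzbar (fun z => (β z : ℂ))) :=
    HasCompactSupport.intro hφc fun z hz => dzbar_eq_zero_of_notMem hz
  obtain ⟨M, hM⟩ := hdc.exists_bound_of_continuous (contDiff_dzbar hφ).continuous
  refine ⟨M, (norm_nonneg _).trans (hM 0), fun r hr => ?_⟩
  have hd : ∀ z, dzbar (fun z : ℂ => (β (r⁻¹ • z) : ℂ)) z =
      (r⁻¹ : ℝ) * dzbar (fun z => (β z : ℂ)) (r⁻¹ • z) := by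
    intro z
    simp only [dzbar]
    rw [fderiv_comp_smul (f := fun z => (β z : ℂ))]
    simp only [smul_apply, Complex.real_smul]
    ring
  have hone : ∀ z : ℂ, ‖z‖ < r → (β (r⁻¹ • z) : ℂ) = 1 := by
    intro z hz
    rw [β.one_of_mem_closedBall]
    · simp
    · simp only [Metric.mem_closedBall, dist_zero_right, norm_smul, norm_inv, Real.norm_eq_abs,
        abs_of_pos hr]
      rw [inv_mul_le_iff₀ hr]
      simpa [β] using hz.le
  refine ⟨fun z => (β (r⁻¹ • z) : ℂ), hφ.comp (contDiff_const_smul _), fun z => ?_, hone, ?_,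
    fun z => ?_, fun z hz => ?_⟩
  · rw [Complex.norm_real, Real.norm_of_nonneg β.nonneg]
    exact β.le_one
  · intro z hz
    have hsub : tsupport (fun z : ℂ => (β (r⁻¹ • z) : ℂ)) ⊆ Metric.closedBall 0 (2 * r) := by
      refine closure_minimal (fun z hz => ?_) Metric.isClosed_closedBall
      by_contra hn
      refine hz ?_
      simp only [Metric.mem_closedBall, dist_zero_right, not_le] at hn
      simp only [Complex.ofReal_eq_zero]
      refine β.zero_of_le_dist ?_
      simp only [dist_zero_right, norm_smul, norm_inv, Real.norm_eq_abs, abs_of_pos hr]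
      rw [le_inv_mul_iff₀ hr]
      change r * 2 ≤ ‖z‖
      linarith
    simpa using hsub hz
  · rw [hd, norm_mul, Complex.norm_real, norm_inv, Real.norm_of_nonneg hr.le, div_eq_inv_mul]
    exact mul_le_mul_of_nonneg_left (hM _) (by positivity)
  · have : (fun z : ℂ => (β (r⁻¹ • z) : ℂ)) =ᶠ[nhds z] fun _ => 1 := by
      filter_upwards [(isOpen_lt continuous_norm continuous_const).mem_nhds hz] with y hy
      exact hone y hy
    simp only [dzbar, this.fderiv_eq]
    simp

/-- The estimate on a single frequency, at the scale `δ = |σ| ^ (-1 / (2 m))`. -/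
theorem exists_slice_estimate {m k : ℕ} (hm : 1 ≤ m) {c₀ c₁ : ℝ} (hc₀ : 0 < c₀) (hc₁ : 0 ≤ c₁) :
    ∃ C : ℝ, 0 ≤ C ∧ ∀ (s₀ : ℝ) (a w : ℂ → ℂ) (b : ℂ → ℝ), (s₀ = 1 ∨ s₀ = -1) →
      ContDiff ℝ ∞ a → ContDiff ℝ ∞ w → HasCompactSupport w → (∀ z ∈ tsupport w, ‖z‖ ≤ 1) →
      (∀ z ∈ tsupport w, dzbar a z = b z) →
      (∀ z ∈ tsupport w, c₀ * ‖z‖ ^ (2 * (m - 1)) ≤ s₀ * b z) →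
      (∀ z ∈ tsupport w, |b z| ≤ c₁ * ‖z‖ ^ (2 * (m - 1))) →
      ∀ σ δ : ℝ, 0 < δ → δ ≤ 1 → |σ| * δ ^ (2 * m) = 1 →
        δ ^ (2 * k) * ∫ z, ‖w z‖ ^ 2 ≤ C * δ ^ 2 *
          ((∫ z, ‖sliceLbar a σ w z‖ ^ 2) + ∫ z, ‖conj z ^ k * sliceL a σ w z‖ ^ 2) := by
  obtain ⟨M, hM0, hM⟩ := exists_cutoff
  -- Chosen so that `8 c₁ t ≤ 1`, which is the smallness that the Poincaré inequality needs on the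
  -- disc of radius `tδ`.
  set t : ℝ := 1 / (1 + 8 * c₁) with ht
  have ht0 : 0 < t := by positivity
  have ht1 : t ≤ 1 := by rw [ht, div_le_one (by positivity)]; linarith
  have htc : 8 * c₁ * t ≤ 1 := by
    rw [ht, mul_one_div, div_le_one (by positivity)]; linarith
  set n := m - 1 + k with hn
  -- The `16` comes from the Poincaré inequality; `64 M² = 8(2r)² · 2(M/r)² ` is the cutoff error,
  -- and the `1` beside it is the mass outside the disc.
  refine ⟨16 + (64 * M ^ 2 + 1) * (2 / t) ^ (2 * n) / (2 * c₀), by positivity, ?_⟩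
  intro s₀ a w b hs₀ ha hw hc hw1 hb hlow hup σ δ hδ0 hδ1 hσδ
  set E := (∫ z, ‖sliceLbar a σ w z‖ ^ 2) + ∫ z, ‖conj z ^ k * sliceL a σ w z‖ ^ 2 with hE
  set J := ∫ z, ‖z‖ ^ (2 * n) * ‖w z‖ ^ 2 with hJ
  have hJE : 2 * c₀ * |σ| * J ≤ E := weighted_le_energy hs₀ hc₀.le ha hw hc hw1 hb hlow σ
  -- The cutoff lives in the disc of radius `2r = tδ`.
  set r := t * δ / 2 with hr
  have hr0 : 0 < r := by positivity
  obtain ⟨χ, hχ, hχ1, hχone, hχs, hχd, hχd0⟩ := hM r hr0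
  have hu : ContDiff ℝ ∞ (fun z => χ z * w z) := hχ.mul hw
  have huc : HasCompactSupport (fun z => χ z * w z) := hc.mul_left
  have hsw : tsupport (fun z => χ z * w z) ⊆ tsupport w := tsupport_mul_subset_right
  have hsχ : tsupport (fun z => χ z * w z) ⊆ tsupport χ := tsupport_mul_subset_left
  have hwc := hw.continuous
  have iw := integrable_norm_sq hwc hc
  have iu := integrable_norm_sq hu.continuous huc
  have iJ := integrable_mul_norm_sq (p := fun z => ‖z‖ ^ (2 * n)) (by fun_prop) hwc hc
  have iLb := integrable_norm_sq (contDiff_sliceLbar ha hw σ).continuous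
    (hasCompactSupport_sliceLbar σ hc)
  have iLbu := integrable_norm_sq (contDiff_sliceLbar ha hu σ).continuous
    (hasCompactSupport_sliceLbar σ huc)
  have hσ0 : 0 < |σ| := by
    rcases (abs_nonneg σ).eq_or_lt with h | h
    · rw [← h] at hσδ; simp at hσδ
    · exact h
  -- Outside the disc the degenerate weight is bounded below; this handles both the mass there and
  -- the terms where `χ` is differentiated.
  have hfar : ∀ z : ℂ, ¬ ‖z‖ < r → 1 ≤ ((r ^ (2 * n))⁻¹ : ℝ) * ‖z‖ ^ (2 * n) := by
    intro z hz
    rw [le_inv_mul_iff₀ (by positivity), mul_one]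
    exact pow_le_pow_left₀ hr0.le (not_lt.1 hz) _
  have hpoin : ∫ z, ‖χ z * w z‖ ^ 2 ≤
      8 * (2 * r) ^ 2 * ∫ z, ‖sliceLbar a σ (fun z => χ z * w z) z‖ ^ 2 := by
    refine poincare_sliceLbar (B := c₁ * (2 * r) ^ (2 * (m - 1))) ha hu huc
      (fun z hz => hb z (hsw hz)) (fun z hz => hχs z (hsχ hz)) (fun z hz => ?_) ?_
    · refine (hup z (hsw hz)).trans (mul_le_mul_of_nonneg_left ?_ hc₁)
      exact pow_le_pow_left₀ (norm_nonneg _) (hχs z (hsχ hz)) _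
    · have e1 : 2 * r = t * δ := by rw [hr]; ring
      have e2 : 2 * m = 2 * (m - 1) + 2 := by omega
      have e3 : 8 * (t * δ) ^ 2 * (|σ| * (c₁ * (t * δ) ^ (2 * (m - 1)))) =
          8 * c₁ * t ^ (2 * m) * (|σ| * δ ^ (2 * m)) := by
        rw [e2]; ring
      rw [e1, e3, hσδ, mul_one]
      refine le_trans ?_ htc
      exact mul_le_mul_of_nonneg_left (pow_le_of_le_one ht0.le ht1 (by omega)) (by positivity)
  have hsplit : ∫ z, ‖w z‖ ^ 2 ≤ (∫ z, ‖χ z * w z‖ ^ 2) + (r ^ (2 * n))⁻¹ * J := by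
    rw [hJ, ← integral_const_mul, ← integral_add iu (iJ.const_mul _)]
    refine integral_mono iw (iu.add (iJ.const_mul _)) fun z => ?_
    by_cases hz : ‖z‖ < r
    · rw [hχone z hz, one_mul]
      have : 0 ≤ (r ^ (2 * n))⁻¹ * (‖z‖ ^ (2 * n) * ‖w z‖ ^ 2) := by positivity
      linarith
    · have h1 := mul_le_mul_of_nonneg_right (hfar z hz) (show 0 ≤ ‖w z‖ ^ 2 by positivity)
      have h2 : 0 ≤ ‖χ z * w z‖ ^ 2 := by positivity
      linarith
  have hLbu : ∫ z, ‖sliceLbar a σ (fun z => χ z * w z) z‖ ^ 2 ≤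
      2 * (∫ z, ‖sliceLbar a σ w z‖ ^ 2) + 2 * (M / r) ^ 2 * (r ^ (2 * n))⁻¹ * J := by
    rw [hJ, ← integral_const_mul, ← integral_const_mul,
      ← integral_add (iLb.const_mul _) (iJ.const_mul _)]
    refine integral_mono iLbu ((iLb.const_mul _).add (iJ.const_mul _)) fun z => ?_
    rw [sliceLbar_mul σ (hχ.differentiable (by simp) z) (hw.differentiable (by simp) z)]
    have h1 : ‖χ z * sliceLbar a σ w z + dzbar χ z * w z‖ ≤
        ‖sliceLbar a σ w z‖ + ‖dzbar χ z * w z‖ := by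
      refine (norm_add_le _ _).trans (add_le_add_left ?_ _)
      rw [norm_mul]
      exact mul_le_of_le_one_left (norm_nonneg _) (hχ1 z)
    have h2 : ‖dzbar χ z * w z‖ ^ 2 ≤ (M / r) ^ 2 * ((r ^ (2 * n))⁻¹ * ‖z‖ ^ (2 * n)) *
        ‖w z‖ ^ 2 := by
      rw [norm_mul, mul_pow]
      refine mul_le_mul_of_nonneg_right ?_ (by positivity)
      by_cases hz : ‖z‖ < r
      · rw [hχd0 z hz, norm_zero, zero_pow two_ne_zero]
        positivity
      · calc ‖dzbar χ z‖ ^ 2 ≤ (M / r) ^ 2 := pow_le_pow_left₀ (norm_nonneg _) (hχd z) 2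
          _ ≤ _ := le_mul_of_one_le_right (by positivity) (hfar z hz)
    have h3 := pow_le_pow_left₀ (norm_nonneg _) h1 2
    nlinarith [sq_nonneg (‖sliceLbar a σ w z‖ - ‖dzbar χ z * w z‖)]
  have n1 : 0 ≤ ∫ z, ‖sliceLbar a σ w z‖ ^ 2 := integral_nonneg fun z => by positivity
  have n2 : 0 ≤ ∫ z, ‖conj z ^ k * sliceL a σ w z‖ ^ 2 := integral_nonneg fun z => by positivity
  have nE : 0 ≤ E := add_nonneg n1 n2
  have hsum : ∫ z, ‖w z‖ ^ 2 ≤ 16 * (t * δ) ^ 2 * E +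
      (64 * M ^ 2 + 1) * ((r ^ (2 * n))⁻¹ * J) := by
    have h1 := mul_le_mul_of_nonneg_left hLbu (show 0 ≤ 8 * (2 * r) ^ 2 by positivity)
    have h2 : 8 * (2 * r) ^ 2 * (2 * (∫ z, ‖sliceLbar a σ w z‖ ^ 2) +
        2 * (M / r) ^ 2 * (r ^ (2 * n))⁻¹ * J) =
        16 * (2 * r) ^ 2 * (∫ z, ‖sliceLbar a σ w z‖ ^ 2) +
          64 * M ^ 2 * ((r ^ (2 * n))⁻¹ * J) := by
      field_simp; ring
    have e1 : 2 * r = t * δ := by rw [hr]; ring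
    rw [h2] at h1
    rw [e1] at h1 hpoin
    have h3 : 16 * (t * δ) ^ 2 * (∫ z, ‖sliceLbar a σ w z‖ ^ 2) ≤ 16 * (t * δ) ^ 2 * E :=
      mul_le_mul_of_nonneg_left (by linarith) (by positivity)
    linarith
  have hA : δ ^ (2 * k) * (16 * (t * δ) ^ 2 * E) ≤ 16 * δ ^ 2 * E := by
    have h1 : δ ^ (2 * k) ≤ 1 := pow_le_one₀ hδ0.le hδ1
    have h2 : t ^ 2 ≤ 1 := pow_le_one₀ ht0.le ht1
    have h3 : δ ^ (2 * k) * t ^ 2 ≤ 1 := mul_le_one₀ h1 (by positivity) h2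
    have h4 := mul_le_mul_of_nonneg_right h3 (show 0 ≤ 16 * δ ^ 2 * E by positivity)
    linarith
  have hB : δ ^ (2 * k) * ((r ^ (2 * n))⁻¹ * J) ≤
      (2 / t) ^ (2 * n) / (2 * c₀) * (δ ^ 2 * E) := by
    -- This is the weighted estimate with `|σ|⁻¹ = δ^(2m)`.
    have h1 : J ≤ δ ^ (2 * m) * E / (2 * c₀) := by
      rw [le_div_iff₀ (by positivity)]
      have := mul_le_mul_of_nonneg_left hJE (show 0 ≤ δ ^ (2 * m) by positivity)
      calc J * (2 * c₀) = (|σ| * δ ^ (2 * m)) * (J * (2 * c₀)) := by rw [hσδ, one_mul]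
        _ = δ ^ (2 * m) * (2 * c₀ * |σ| * J) := by ring
        _ ≤ _ := this
    have h2 : δ ^ (2 * k) * (r ^ (2 * n))⁻¹ * δ ^ (2 * m) = (2 / t) ^ (2 * n) * δ ^ 2 := by
      have e1 : 2 * k + 2 * m = 2 * n + 2 := by omega
      have e2 : δ ^ (2 * k) * δ ^ (2 * m) = δ ^ (2 * n) * δ ^ 2 := by
        rw [← pow_add, ← pow_add, e1]
      rw [hr, div_pow, div_pow, mul_pow]
      field_simp
      linear_combination e2
    have h3 := mul_le_mul_of_nonneg_left h1
      (show 0 ≤ δ ^ (2 * k) * (r ^ (2 * n))⁻¹ by positivity)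
    calc δ ^ (2 * k) * ((r ^ (2 * n))⁻¹ * J) = δ ^ (2 * k) * (r ^ (2 * n))⁻¹ * J := by ring
      _ ≤ _ := h3
      _ = (δ ^ (2 * k) * (r ^ (2 * n))⁻¹ * δ ^ (2 * m)) * E / (2 * c₀) := by ring
      _ = _ := by rw [h2]; ring
  have hfin := mul_le_mul_of_nonneg_left hsum (show 0 ≤ δ ^ (2 * k) by positivity)
  have hB' := mul_le_mul_of_nonneg_left hB (show 0 ≤ 64 * M ^ 2 + 1 by positivity)
  refine hfin.trans ?_
  have e : (16 + (64 * M ^ 2 + 1) * (2 / t) ^ (2 * n) / (2 * c₀)) * δ ^ 2 * E =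
      16 * δ ^ 2 * E + (64 * M ^ 2 + 1) * ((2 / t) ^ (2 * n) / (2 * c₀) * (δ ^ 2 * E)) := by ring
  rw [e]
  linarith

/-! ### Test functions and their partial Fourier transform. -/

/-- Smooth compactly supported functions on `ℂ × ℝ` with support in `{|z| < ε}`. -/
structure IsTestFunction (ε : ℝ) (v : ℂ × ℝ → ℂ) : Prop where
  contDiff : ContDiff ℝ ∞ v
  hasCompactSupport : HasCompactSupport v
  tsupport_subset : tsupport v ⊆ {p | ‖p.1‖ < ε}

namespace IsTestFunction

variable {ε : ℝ} {u v : ℂ × ℝ → ℂ}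

theorem add (hu : IsTestFunction ε u) (hv : IsTestFunction ε v) :
    IsTestFunction ε (fun p => u p + v p) where
  contDiff := hu.contDiff.add hv.contDiff
  hasCompactSupport := hu.hasCompactSupport.add hv.hasCompactSupport
  tsupport_subset := (tsupport_add u v).trans (Set.union_subset hu.tsupport_subset
    hv.tsupport_subset)

theorem fst_mul {a : ℂ → ℂ} (ha : ContDiff ℝ ∞ a) (hv : IsTestFunction ε v) :
    IsTestFunction ε (fun p => a p.1 * v p) where
  contDiff := (ha.comp contDiff_fst).mul hv.contDiff
  hasCompactSupport := hv.hasCompactSupport.mul_left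
  tsupport_subset := tsupport_mul_subset_right.trans hv.tsupport_subset

theorem const_mul (c : ℂ) (hv : IsTestFunction ε v) : IsTestFunction ε (fun p => c * v p) :=
  hv.fst_mul (a := fun _ => c) contDiff_const

theorem fderiv_apply (hv : IsTestFunction ε v) (e : ℂ × ℝ) :
    IsTestFunction ε (fun p => fderiv ℝ v p e) where
  contDiff := contDiff_fderiv_apply hv.contDiff e
  hasCompactSupport := hv.hasCompactSupport.fderiv_apply (𝕜 := ℝ) e
  tsupport_subset := (tsupport_fderiv_apply_subset ℝ e).trans hv.tsupport_subset

theorem differentiable (hv : IsTestFunction ε v) : Differentiable ℝ v :=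
  hv.contDiff.differentiable (by simp)

theorem eq_zero (hv : IsTestFunction ε v) {p : ℂ × ℝ} (hp : ¬ ‖p.1‖ < ε) : v p = 0 :=
  image_eq_zero_of_notMem_tsupport fun h => hp (hv.tsupport_subset h)

end IsTestFunction

theorem fderiv_comp_prodMk_left {v : ℂ × ℝ → ℂ} (hv : Differentiable ℝ v) (p : ℂ × ℝ) (e : ℂ) :
    fderiv ℝ (fun z => v (z, p.2)) p.1 e = fderiv ℝ v p (e, 0) := by
  have h := (hv p).hasFDerivAt.comp p.1 (hasFDerivAt_prodMk_left (𝕜 := ℝ) p.1 p.2)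
  rw [show (fun z => v (z, p.2)) = v ∘ fun z => (z, p.2) from rfl, h.fderiv]
  simp

theorem deriv_comp_prodMk_right {v : ℂ × ℝ → ℂ} (hv : Differentiable ℝ v) (p : ℂ × ℝ) :
    deriv (fun t => v (p.1, t)) p.2 = fderiv ℝ v p (0, 1) := by
  have h := (hv p).hasFDerivAt.comp p.2 (hasFDerivAt_prodMk_right (𝕜 := ℝ) p.1 p.2)
  have h2 := h.hasDerivAt
  rw [show (fun t => v (p.1, t)) = v ∘ fun t => (p.1, t) from rfl, h2.deriv]
  simp

/-- Directional derivatives of `v` on the product keep the result a test function and are easy to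
transform. -/
theorem vecL_eq {F : ℂ → ℝ} {v : ℂ × ℝ → ℂ} (hv : Differentiable ℝ v) (p : ℂ × ℝ) :
    vecL F v p = ((1 / 2) * fderiv ℝ v p (1, 0) + (-Complex.I / 2) * fderiv ℝ v p (Complex.I, 0)) +
      Complex.I * Fz F p.1 * fderiv ℝ v p (0, 1) := by
  simp only [vecL, dz, fderiv_comp_prodMk_left hv, deriv_comp_prodMk_right hv]
  ring

theorem vecLbar_eq {F : ℂ → ℝ} {v : ℂ × ℝ → ℂ} (hv : Differentiable ℝ v) (p : ℂ × ℝ) :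
    vecLbar F v p =
      ((1 / 2) * fderiv ℝ v p (1, 0) + (Complex.I / 2) * fderiv ℝ v p (Complex.I, 0)) +
      (-Complex.I * conj (Fz F p.1)) * fderiv ℝ v p (0, 1) := by
  simp only [vecLbar, dzbar, fderiv_comp_prodMk_left hv, deriv_comp_prodMk_right hv]
  ring

theorem IsTestFunction.vecL {ε : ℝ} {v : ℂ × ℝ → ℂ} (hv : IsTestFunction ε v) {F : ℂ → ℝ}
    (hF : ContDiff ℝ ∞ (Fz F)) : IsTestFunction ε (vecL F v) := by
  rw [show DegenerateSquares.vecL F v = _ from funext (vecL_eq hv.differentiable)]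
  exact (((hv.fderiv_apply _).const_mul _).add ((hv.fderiv_apply _).const_mul _)).add
    ((hv.fderiv_apply _).fst_mul (a := fun z => Complex.I * Fz F z) (contDiff_const.mul hF))

theorem IsTestFunction.vecLbar {ε : ℝ} {v : ℂ × ℝ → ℂ} (hv : IsTestFunction ε v) {F : ℂ → ℝ}
    (hF : ContDiff ℝ ∞ (Fz F)) : IsTestFunction ε (vecLbar F v) := by
  rw [show DegenerateSquares.vecLbar F v = _ from funext (vecLbar_eq hv.differentiable)]
  exact (((hv.fderiv_apply _).const_mul _).add ((hv.fderiv_apply _).const_mul _)).add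
    ((hv.fderiv_apply _).fst_mul (a := fun z => -Complex.I * conj (Fz F z))
      (contDiff_const.mul (contDiff_conj hF)))

/-- A continuous compactly supported function on `ℂ × ℝ` is dominated by an integrable
function of the second variable. -/
theorem exists_integrable_bound {E : Type*} [NormedAddCommGroup E] {f : ℂ × ℝ → E}
    (hf : Continuous f) (hc : HasCompactSupport f) :
    ∃ B : ℝ → ℝ, Integrable B ∧ ∀ z t, ‖f (z, t)‖ ≤ B t := by
  obtain ⟨M, hM⟩ := hc.exists_bound_of_continuous hf
  have hK : IsCompact (Prod.snd '' tsupport f) := hc.isCompact.image continuous_snd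
  refine ⟨(Prod.snd '' tsupport f).indicator fun _ => M, ?_, fun z t => ?_⟩
  · rw [integrable_indicator_iff hK.measurableSet]
    exact integrableOn_const hK.measure_lt_top.ne
  · by_cases ht : t ∈ Prod.snd '' tsupport f
    · rw [Set.indicator_of_mem ht]
      exact hM _
    · rw [Set.indicator_of_notMem ht, image_eq_zero_of_notMem_tsupport fun h => ht ⟨_, h, rfl⟩,
        norm_zero]

theorem fourierT_eq (v : ℂ × ℝ → ℂ) (q : ℂ × ℝ) :
    fourierT v q =
      ∫ t, Complex.exp (((-2 * Real.pi * t * q.2 : ℝ) : ℂ) * Complex.I) * v (q.1, t) := by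
  rw [fourierT, Real.fourier_real_eq_integral_exp_smul]
  rfl

section

variable {ε : ℝ} {u v : ℂ × ℝ → ℂ}

theorem IsTestFunction.integrable_slice (hv : IsTestFunction ε v) (q : ℂ × ℝ) :
    Integrable
      fun t => Complex.exp (((-2 * Real.pi * t * q.2 : ℝ) : ℂ) * Complex.I) * v (q.1, t) := by
  obtain ⟨B, hB, hBv⟩ := exists_integrable_bound hv.contDiff.continuous hv.hasCompactSupport
  have h1 := hv.contDiff.continuous
  refine hB.mono' (Continuous.aestronglyMeasurable (by fun_prop))
    (Filter.Eventually.of_forall fun t => ?_)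
  rw [norm_mul, Complex.norm_exp_ofReal_mul_I, one_mul]
  exact hBv _ _

theorem IsTestFunction.continuous_fourierT (hv : IsTestFunction ε v) :
    Continuous (fourierT v) := by
  obtain ⟨B, hB, hBv⟩ := exists_integrable_bound hv.contDiff.continuous hv.hasCompactSupport
  have h1 := hv.contDiff.continuous
  rw [show fourierT v = _ from funext (fourierT_eq v)]
  refine continuous_of_dominated (fun q => (hv.integrable_slice q).1)
    (fun q => Filter.Eventually.of_forall fun t => ?_) hB
    (Filter.Eventually.of_forall fun t => by fun_prop)
  rw [norm_mul, Complex.norm_exp_ofReal_mul_I, one_mul]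
  exact hBv _ _

theorem IsTestFunction.exists_norm_fourierT_le (hv : IsTestFunction ε v) :
    ∃ C : ℝ, ∀ q, ‖fourierT v q‖ ≤ C := by
  obtain ⟨B, hB, hBv⟩ := exists_integrable_bound hv.contDiff.continuous hv.hasCompactSupport
  refine ⟨∫ t, B t, fun q => ?_⟩
  rw [fourierT_eq]
  refine norm_integral_le_of_norm_le hB (Filter.Eventually.of_forall fun t => ?_)
  rw [norm_mul, Complex.norm_exp_ofReal_mul_I, one_mul]
  exact hBv _ _

theorem fourierT_add (hu : IsTestFunction ε u) (hv : IsTestFunction ε v) (q : ℂ × ℝ) :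
    fourierT (fun p => u p + v p) q = fourierT u q + fourierT v q := by
  simp only [fourierT_eq, mul_add]
  exact integral_add (hu.integrable_slice q) (hv.integrable_slice q)

theorem fourierT_fst_mul (a : ℂ → ℂ) (v : ℂ × ℝ → ℂ) (q : ℂ × ℝ) :
    fourierT (fun p => a p.1 * v p) q = a q.1 * fourierT v q := by
  simp only [fourierT_eq, mul_left_comm _ (a q.1)]
  exact integral_const_mul _ _

theorem fourierT_const_mul (c : ℂ) (v : ℂ × ℝ → ℂ) (q : ℂ × ℝ) :
    fourierT (fun p => c * v p) q = c * fourierT v q :=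
  fourierT_fst_mul (fun _ => c) v q

theorem IsTestFunction.fourierT_eq_zero (hv : IsTestFunction ε v) {q : ℂ × ℝ}
    (hq : ¬ ‖q.1‖ < ε) : fourierT v q = 0 := by
  rw [fourierT_eq]
  have : ∀ t, v (q.1, t) = 0 := fun t => hv.eq_zero hq
  simp [this]

theorem IsTestFunction.fourierT_deriv (hv : IsTestFunction ε v) (q : ℂ × ℝ) :
    fourierT (fun p => fderiv ℝ v p (0, 1)) q =
      2 * Real.pi * Complex.I * q.2 * fourierT v q := by
  have hint : ∀ {w : ℂ × ℝ → ℂ}, IsTestFunction ε w → Integrable fun t => w (q.1, t) := by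
    intro w hw
    have := hw.integrable_slice (q.1, 0)
    simpa using this
  have e : deriv (fun t => v (q.1, t)) = fun t => fderiv ℝ v (q.1, t) (0, 1) := by
    funext t
    exact deriv_comp_prodMk_right hv.differentiable (q.1, t)
  have h := Real.fourier_deriv (f := fun t => v (q.1, t)) (hint hv)
    (fun t => (hv.differentiable (q.1, t)).comp t (by fun_prop))
    (by rw [e]; exact hint (hv.fderiv_apply (0, 1)))
  have h2 := congrFun h q.2
  rw [e] at h2
  simpa [fourierT] using h2

theorem IsTestFunction.hasFDerivAt_fourierT (hv : IsTestFunction ε v) (q : ℂ × ℝ) :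
    ∃ L : ℂ →L[ℝ] ℂ, HasFDerivAt (fun z => fourierT v (z, q.2)) L q.1 ∧
      ∀ e, L e = fourierT (fun p => fderiv ℝ v p (e, 0)) q := by
  have hcf : Continuous (fderiv ℝ v) := hv.contDiff.continuous_fderiv (by simp)
  obtain ⟨B, hB, hBv⟩ := exists_integrable_bound hcf (hv.hasCompactSupport.fderiv (𝕜 := ℝ))
  let c : ℝ → ℂ := fun t => Complex.exp (((-2 * Real.pi * t * q.2 : ℝ) : ℂ) * Complex.I)
  have hcc : Continuous c := by fun_prop
  let F' : ℂ → ℝ → ℂ →L[ℝ] ℂ := fun z t =>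
    c t • (fderiv ℝ v (z, t)).comp (ContinuousLinearMap.inl ℝ ℂ ℝ)
  have hF'c : ∀ z, Continuous (F' z) := by
    intro z
    have h1 : Continuous fun t : ℝ => fderiv ℝ v (z, t) := by fun_prop
    exact hcc.smul (h1.clm_comp continuous_const)
  have hF'b : ∀ z t, ‖F' z t‖ ≤ B t := by
    intro z t
    rw [norm_smul, Complex.norm_exp_ofReal_mul_I, one_mul]
    refine (ContinuousLinearMap.opNorm_comp_le _ _).trans ?_
    refine le_trans (mul_le_of_le_one_right (norm_nonneg _) ?_) (hBv z t)
    exact ContinuousLinearMap.norm_inl_le_one ℝ ℂ ℝ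
  have hF'i : Integrable (F' q.1) :=
    hB.mono' (hF'c _).aestronglyMeasurable (Filter.Eventually.of_forall (hF'b _))
  refine ⟨∫ t, F' q.1 t, ?_, fun e => ?_⟩
  · simp only [fourierT_eq]
    refine hasFDerivAt_integral_of_dominated_of_fderiv_le (bound := B) Filter.univ_mem
      (Filter.Eventually.of_forall fun z => (hv.integrable_slice (z, q.2)).1)
      (hv.integrable_slice q) (hF'c _).aestronglyMeasurable
      (Filter.Eventually.of_forall fun t z _ => hF'b z t) hB
      (Filter.Eventually.of_forall fun t z _ => ?_)
    exact ((hv.differentiable (z, t)).hasFDerivAt.comp z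
      (hasFDerivAt_prodMk_left (𝕜 := ℝ) z t)).const_mul (c t)
  · rw [ContinuousLinearMap.integral_apply hF'i, fourierT_eq]
    simp [F', c]

theorem IsTestFunction.fderiv_fourierT (hv : IsTestFunction ε v) (q : ℂ × ℝ) (e : ℂ) :
    fderiv ℝ (fun z => fourierT v (z, q.2)) q.1 e =
      fourierT (fun p => fderiv ℝ v p (e, 0)) q := by
  obtain ⟨L, hL, hLe⟩ := hv.hasFDerivAt_fourierT q
  rw [hL.fderiv, hLe]

/-- Each `z`-derivative of the transform is the transform of a derivative of `v`, again a test
function; hence the induction runs over all `v`. -/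
theorem IsTestFunction.contDiff_fourierT (hv : IsTestFunction ε v) (τ : ℝ) :
    ContDiff ℝ ∞ (fun z => fourierT v (z, τ)) := by
  rw [contDiff_infty]
  intro n
  induction n generalizing v with
  | zero =>
    have := hv.continuous_fourierT
    exact contDiff_zero.2 (by fun_prop)
  | succ n ih =>
    rw [show ((n + 1 : ℕ) : WithTop ℕ∞) = n + 1 by push_cast; rfl, contDiff_succ_iff_fderiv_apply]
    refine ⟨fun z => ?_, by simp, fun e => ?_⟩
    · obtain ⟨L, hL, -⟩ := hv.hasFDerivAt_fourierT (z, τ)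
      exact hL.differentiableAt
    · have e1 : (fun z => fderiv ℝ (fun z => fourierT v (z, τ)) z e) =
          fun z => fourierT (fun p => fderiv ℝ v p (e, 0)) (z, τ) := by
        funext z
        exact hv.fderiv_fourierT (z, τ) e
      rw [e1]
      exact ih (hv.fderiv_apply (e, 0))

theorem IsTestFunction.tsupport_fourierT (hv : IsTestFunction ε v) (τ : ℝ) :
    tsupport (fun z => fourierT v (z, τ)) ⊆ Prod.fst '' tsupport v := by
  refine closure_minimal (fun z hz => ?_) (hv.hasCompactSupport.isCompact.image
    continuous_fst).isClosed
  by_contra hn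
  refine hz ?_
  have : ∀ t, v (z, t) = 0 := fun t => image_eq_zero_of_notMem_tsupport fun h => hn ⟨_, h, rfl⟩
  simp [fourierT_eq, this]

theorem IsTestFunction.hasCompactSupport_fourierT (hv : IsTestFunction ε v) (τ : ℝ) :
    HasCompactSupport (fun z => fourierT v (z, τ)) :=
  (hv.hasCompactSupport.isCompact.image continuous_fst).of_isClosed_subset (isClosed_tsupport _)
    (hv.tsupport_fourierT τ)

theorem IsTestFunction.norm_lt_of_mem_tsupport_fourierT (hv : IsTestFunction ε v) {τ : ℝ} {z : ℂ}
    (hz : z ∈ tsupport (fun z => fourierT v (z, τ))) : ‖z‖ < ε := by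
  obtain ⟨p, hp, rfl⟩ := hv.tsupport_fourierT τ hz
  exact hv.tsupport_subset hp

theorem IsTestFunction.fourierT_vecL (hv : IsTestFunction ε v) {F : ℂ → ℝ}
    (hF : ContDiff ℝ ∞ (Fz F)) (q : ℂ × ℝ) :
    fourierT (DegenerateSquares.vecL F v) q =
      sliceL (Fz F) (2 * Real.pi * q.2) (fun z => fourierT v (z, q.2)) q.1 := by
  have h1 := (hv.fderiv_apply (1, 0)).const_mul (1 / 2)
  have h2 := (hv.fderiv_apply (Complex.I, 0)).const_mul (-Complex.I / 2)
  have h3 := (hv.fderiv_apply (0, 1)).fst_mul (a := fun z => Complex.I * Fz F z)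
    (contDiff_const.mul hF)
  rw [show DegenerateSquares.vecL F v = _ from funext (vecL_eq hv.differentiable),
    fourierT_add (h1.add h2) h3, fourierT_add h1 h2, fourierT_const_mul, fourierT_const_mul,
    fourierT_fst_mul (fun z => Complex.I * Fz F z), hv.fourierT_deriv, sliceL, dz,
    hv.fderiv_fourierT, hv.fderiv_fourierT]
  push_cast
  linear_combination (2 * Real.pi * q.2 * Fz F q.1 * fourierT v q) * Complex.I_sq

theorem IsTestFunction.fourierT_vecLbar (hv : IsTestFunction ε v) {F : ℂ → ℝ}
    (hF : ContDiff ℝ ∞ (Fz F)) (q : ℂ × ℝ) :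
    fourierT (DegenerateSquares.vecLbar F v) q =
      sliceLbar (Fz F) (2 * Real.pi * q.2) (fun z => fourierT v (z, q.2)) q.1 := by
  have h1 := (hv.fderiv_apply (1, 0)).const_mul (1 / 2)
  have h2 := (hv.fderiv_apply (Complex.I, 0)).const_mul (Complex.I / 2)
  have h3 := (hv.fderiv_apply (0, 1)).fst_mul (a := fun z => -Complex.I * conj (Fz F z))
    (contDiff_const.mul (contDiff_conj hF))
  rw [show DegenerateSquares.vecLbar F v = _ from funext (vecLbar_eq hv.differentiable),
    fourierT_add (h1.add h2) h3, fourierT_add h1 h2, fourierT_const_mul, fourierT_const_mul,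
    fourierT_fst_mul (fun z => -Complex.I * conj (Fz F z)), hv.fourierT_deriv, sliceLbar, dzbar,
    hv.fderiv_fourierT, hv.fderiv_fourierT]
  push_cast
  linear_combination (-2 * Real.pi * q.2 * conj (Fz F q.1) * fourierT v q) * Complex.I_sq

/-- The partial Fourier transform of a test function is rapidly decreasing. -/
theorem IsTestFunction.exists_decay (hv : IsTestFunction ε v) (n : ℕ) :
    ∃ C : ℝ, ∀ q : ℂ × ℝ, (1 + (2 * Real.pi * q.2) ^ 2) ^ n * ‖fourierT v q‖ ≤ C := by
  induction n generalizing v with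
  | zero => simpa using hv.exists_norm_fourierT_le
  | succ n ih =>
    -- One more factor `1 + (2πτ)²` is gained by passing from `v` to `v - ∂_t² v`.
    have h1 := ((hv.fderiv_apply (0, 1)).fderiv_apply (0, 1)).const_mul (-1)
    obtain ⟨C, hC⟩ := ih (hv.add h1)
    refine ⟨C, fun q => le_trans (le_of_eq ?_) (hC q)⟩
    rw [fourierT_add hv h1, fourierT_const_mul, (hv.fderiv_apply (0, 1)).fourierT_deriv,
      hv.fourierT_deriv]
    have e : fourierT v q + -1 * (2 * Real.pi * Complex.I * q.2 *
        (2 * Real.pi * Complex.I * q.2 * fourierT v q)) =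
        ((1 + (2 * Real.pi * q.2) ^ 2 : ℝ) : ℂ) * fourierT v q := by
      push_cast
      linear_combination (-(2 * Real.pi * q.2) ^ 2 * fourierT v q) * Complex.I_sq
    rw [e, norm_mul, Complex.norm_real, Real.norm_of_nonneg (by positivity)]
    ring

theorem continuous_weight (s : ℝ) :
    Continuous fun q : ℂ × ℝ => (1 + (2 * Real.pi * q.2) ^ 2) ^ s := by
  refine Continuous.rpow_const (by fun_prop) fun q => Or.inl ?_
  positivity

theorem integrable_weight_mul (hu : IsTestFunction ε u) (hv : IsTestFunction ε v) (s : ℝ) :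
    Integrable fun q : ℂ × ℝ => (((1 + (2 * Real.pi * q.2) ^ 2) ^ s : ℝ) : ℂ) *
      (fourierT u q * conj (fourierT v q)) := by
  -- The extra power beyond `s` leaves the integrable factor `(1 + (2πτ)²)⁻¹`; in `z` the support
  -- lies in a ball.
  obtain ⟨n, hn⟩ := exists_nat_ge (s + 1)
  obtain ⟨C, hC⟩ := hu.exists_decay n
  obtain ⟨D, hD⟩ := hv.exists_norm_fourierT_le
  have hdom : Integrable fun q : ℂ × ℝ => (Metric.ball (0 : ℂ) ε).indicator (fun _ => C * D) q.1 *
      (1 + (2 * Real.pi * q.2) ^ 2)⁻¹ := by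
    refine Integrable.mul_prod (μ := (volume : Measure ℂ)) (ν := (volume : Measure ℝ))
      (f := (Metric.ball (0 : ℂ) ε).indicator fun _ => C * D)
      (g := fun τ : ℝ => (1 + (2 * Real.pi * τ) ^ 2)⁻¹) ?_ ?_
    · rw [integrable_indicator_iff measurableSet_ball]
      exact integrableOn_const measure_ball_lt_top.ne
    · exact integrable_inv_one_add_sq.comp_mul_left' (by positivity)
  have hcont : Continuous fun q : ℂ × ℝ => (((1 + (2 * Real.pi * q.2) ^ 2) ^ s : ℝ) : ℂ) *
      (fourierT u q * conj (fourierT v q)) :=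
    (Complex.continuous_ofReal.comp (continuous_weight s)).mul
      (hu.continuous_fourierT.mul (Complex.continuous_conj.comp hv.continuous_fourierT))
  refine hdom.mono' hcont.aestronglyMeasurable (Filter.Eventually.of_forall fun q => ?_)
  by_cases hq : ‖q.1‖ < ε
  · rw [Set.indicator_of_mem (by simpa using hq), norm_mul, norm_mul, RCLike.norm_conj,
      Complex.norm_real]
    set x := 1 + (2 * Real.pi * q.2) ^ 2 with hx
    have hx1 : 1 ≤ x := by rw [hx]; nlinarith [sq_nonneg (2 * Real.pi * q.2)]
    have hx0 : 0 < x := by linarith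
    have h1 : x ^ s ≤ x ^ n * x⁻¹ := by
      rw [← Real.rpow_natCast, ← Real.rpow_neg_one, ← Real.rpow_add hx0]
      exact Real.rpow_le_rpow_of_exponent_le hx1 (by linarith)
    rw [Real.norm_of_nonneg (by positivity)]
    have hD0 : 0 ≤ D := (norm_nonneg _).trans (hD q)
    calc x ^ s * (‖fourierT u q‖ * ‖fourierT v q‖)
        ≤ (x ^ n * x⁻¹) * (‖fourierT u q‖ * D) := by
          gcongr
          exact hD q
      _ = (x ^ n * ‖fourierT u q‖) * D * x⁻¹ := by ring
      _ ≤ C * D * x⁻¹ := by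
          gcongr
          exact hC q
  · rw [hu.fourierT_eq_zero hq, Set.indicator_of_notMem (by simpa using hq)]
    simp

theorem integrable_weight_norm_sq (hv : IsTestFunction ε v) (s : ℝ) :
    Integrable fun q : ℂ × ℝ => (1 + (2 * Real.pi * q.2) ^ 2) ^ s * ‖fourierT v q‖ ^ 2 := by
  refine (integrable_weight_mul hv hv s).norm.congr (Filter.Eventually.of_forall fun q => ?_)
  simp only [norm_mul, RCLike.norm_conj, Complex.norm_real]
  rw [Real.norm_of_nonneg (by positivity)]
  ring

theorem innerS_eq (hu : IsTestFunction ε u) (hv : IsTestFunction ε v) (s : ℝ) :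
    innerS s u v = ∫ τ : ℝ, (((1 + (2 * Real.pi * τ) ^ 2) ^ s : ℝ) : ℂ) *
      ∫ z : ℂ, fourierT u (z, τ) * conj (fourierT v (z, τ)) := by
  rw [innerS, Measure.volume_eq_prod, integral_prod_symm _ (integrable_weight_mul hu hv s)]
  simp only [integral_const_mul]

theorem normS_sq_eq (hv : IsTestFunction ε v) (s : ℝ) :
    normS s v ^ 2 = ∫ τ : ℝ, (1 + (2 * Real.pi * τ) ^ 2) ^ s *
      ∫ z : ℂ, ‖fourierT v (z, τ)‖ ^ 2 := by
  rw [normS, Real.sq_sqrt (integral_nonneg fun q => by positivity), Measure.volume_eq_prod,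
    integral_prod_symm _ (integrable_weight_norm_sq hv s)]
  simp only [integral_const_mul]

theorem integrable_weight_slice (hv : IsTestFunction ε v) (s : ℝ) :
    Integrable fun τ : ℝ => (1 + (2 * Real.pi * τ) ^ 2) ^ s *
      ∫ z : ℂ, ‖fourierT v (z, τ)‖ ^ 2 := by
  simpa only [integral_const_mul] using (integrable_weight_norm_sq hv s).integral_prod_right

end

/-! ### The quadratic form of `P` and the energy identity. -/

/-- The factored form shows smoothness at `0` and lets the weight be split between the two copies of
`Lw`. -/
theorem norm_pow_eq_ofReal (k : ℕ) (z : ℂ) :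
    ((‖z‖ ^ (2 * k) : ℝ) : ℂ) = z ^ k * conj z ^ k := by
  rw [← mul_pow, Complex.mul_conj', pow_mul]
  push_cast
  rfl

theorem contDiff_norm_pow_ofReal (k : ℕ) :
    ContDiff ℝ ∞ fun z : ℂ => ((‖z‖ ^ (2 * k) : ℝ) : ℂ) := by
  simp only [norm_pow_eq_ofReal]
  exact (contDiff_id.pow k).mul (contDiff_conj_pow k)

/-- The quadratic form of the operator on a single frequency. -/
theorem integral_slice_op {a w : ℂ → ℂ} (ha : ContDiff ℝ ∞ a) (hw : ContDiff ℝ ∞ w)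
    (hc : HasCompactSupport w) (σ : ℝ) (k : ℕ) :
    ∫ z, (sliceL a σ (sliceLbar a σ w) z +
        sliceLbar a σ (fun z => ((‖z‖ ^ (2 * k) : ℝ) : ℂ) * sliceL a σ w z) z) * conj (w z) =
      ((-((∫ z, ‖sliceLbar a σ w z‖ ^ 2) + ∫ z, ‖conj z ^ k * sliceL a σ w z‖ ^ 2) : ℝ) : ℂ) := by
  have hL := contDiff_sliceL ha hw σ
  have hLb := contDiff_sliceLbar ha hw σ
  have hkL : ContDiff ℝ ∞ fun z => ((‖z‖ ^ (2 * k) : ℝ) : ℂ) * sliceL a σ w z :=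
    (contDiff_norm_pow_ofReal k).mul hL
  have hkc : HasCompactSupport fun z => ((‖z‖ ^ (2 * k) : ℝ) : ℂ) * sliceL a σ w z :=
    (hasCompactSupport_sliceL σ hc).mul_left
  have hwc := hasCompactSupport_conj hc
  have i1 : Integrable fun z => sliceL a σ (sliceLbar a σ w) z * conj (w z) :=
    ((contDiff_sliceL ha hLb σ).mul (contDiff_conj hw)).continuous.integrable_of_hasCompactSupport
      hwc.mul_left
  have i2 : Integrable fun z =>
      sliceLbar a σ (fun z => ((‖z‖ ^ (2 * k) : ℝ) : ℂ) * sliceL a σ w z) z * conj (w z) :=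
    ((contDiff_sliceLbar ha hkL σ).mul
      (contDiff_conj hw)).continuous.integrable_of_hasCompactSupport hwc.mul_left
  simp only [add_mul]
  rw [integral_add i1 i2, integral_sliceL_mul_conj ha hLb hw hc,
    integral_sliceLbar_mul_conj ha hkL hw hkc, integral_mul_conj_self]
  have e : ∀ z, ((‖z‖ ^ (2 * k) : ℝ) : ℂ) * sliceL a σ w z * conj (sliceL a σ w z) =
      (conj z ^ k * sliceL a σ w z) * conj (conj z ^ k * sliceL a σ w z) := by
    intro z
    simp only [norm_pow_eq_ofReal, map_mul, map_pow, Complex.conj_conj]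
    ring
  simp only [e]
  rw [integral_mul_conj_self]
  push_cast
  ring

section

variable {ε : ℝ} {v : ℂ × ℝ → ℂ}

theorem IsTestFunction.fourierT_opP (hv : IsTestFunction ε v) {F : ℂ → ℝ}
    (hF : ContDiff ℝ ∞ (Fz F)) (k : ℕ) (q : ℂ × ℝ) :
    fourierT (opP k F v) q =
      sliceL (Fz F) (2 * Real.pi * q.2)
        (sliceLbar (Fz F) (2 * Real.pi * q.2) fun z => fourierT v (z, q.2)) q.1 +
      sliceLbar (Fz F) (2 * Real.pi * q.2) (fun z => ((‖z‖ ^ (2 * k) : ℝ) : ℂ) *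
        sliceL (Fz F) (2 * Real.pi * q.2) (fun z => fourierT v (z, q.2)) z) q.1 := by
  have h1 := hv.vecLbar hF
  have h2 := (hv.vecL hF).fst_mul (contDiff_norm_pow_ofReal k)
  change fourierT (fun p => DegenerateSquares.vecL F (DegenerateSquares.vecLbar F v) p +
    DegenerateSquares.vecLbar F (fun q => ((‖q.1‖ ^ (2 * k) : ℝ) : ℂ) *
      DegenerateSquares.vecL F v q) p) q = _
  rw [fourierT_add (h1.vecL hF) (h2.vecLbar hF), h1.fourierT_vecL hF, h2.fourierT_vecLbar hF]
  simp only [hv.fourierT_vecLbar hF,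
    fourierT_fst_mul (fun z : ℂ => ((‖z‖ ^ (2 * k) : ℝ) : ℂ)), hv.fourierT_vecL hF]

theorem IsTestFunction.opP (hv : IsTestFunction ε v) {F : ℂ → ℝ}
    (hF : ContDiff ℝ ∞ (Fz F)) (k : ℕ) : IsTestFunction ε (opP k F v) :=
  ((hv.vecLbar hF).vecL hF).add (((hv.vecL hF).fst_mul (contDiff_norm_pow_ofReal k)).vecLbar hF)

theorem IsTestFunction.normS_vecLbar_sq (hv : IsTestFunction ε v) {F : ℂ → ℝ}
    (hF : ContDiff ℝ ∞ (Fz F)) (s : ℝ) :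
    normS s (DegenerateSquares.vecLbar F v) ^ 2 = ∫ τ : ℝ, (1 + (2 * Real.pi * τ) ^ 2) ^ s *
      ∫ z, ‖sliceLbar (Fz F) (2 * Real.pi * τ) (fun z => fourierT v (z, τ)) z‖ ^ 2 := by
  rw [normS_sq_eq (hv.vecLbar hF)]
  simp only [hv.fourierT_vecLbar hF]

theorem IsTestFunction.normS_conj_pow_vecL_sq (hv : IsTestFunction ε v) {F : ℂ → ℝ}
    (hF : ContDiff ℝ ∞ (Fz F)) (k : ℕ) (s : ℝ) :
    normS s (fun p => conj p.1 ^ k * DegenerateSquares.vecL F v p) ^ 2 =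
      ∫ τ : ℝ, (1 + (2 * Real.pi * τ) ^ 2) ^ s *
        ∫ z, ‖conj z ^ k * sliceL (Fz F) (2 * Real.pi * τ)
          (fun z => fourierT v (z, τ)) z‖ ^ 2 := by
  rw [normS_sq_eq ((hv.vecL hF).fst_mul (contDiff_conj_pow k))]
  simp only [fourierT_fst_mul fun z => conj z ^ k, hv.fourierT_vecL hF]

theorem IsTestFunction.integrable_energy (hv : IsTestFunction ε v) {F : ℂ → ℝ}
    (hF : ContDiff ℝ ∞ (Fz F)) (k : ℕ) (s : ℝ) :
    Integrable (fun τ : ℝ => (1 + (2 * Real.pi * τ) ^ 2) ^ s *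
      ∫ z, ‖sliceLbar (Fz F) (2 * Real.pi * τ) (fun z => fourierT v (z, τ)) z‖ ^ 2) ∧
    Integrable (fun τ : ℝ => (1 + (2 * Real.pi * τ) ^ 2) ^ s *
      ∫ z, ‖conj z ^ k * sliceL (Fz F) (2 * Real.pi * τ) (fun z => fourierT v (z, τ)) z‖ ^ 2) := by
  have h1 := integrable_weight_slice (hv.vecLbar hF) s
  have h2 := integrable_weight_slice ((hv.vecL hF).fst_mul (contDiff_conj_pow k)) s
  simp only [hv.fourierT_vecLbar hF] at h1
  simp only [fourierT_fst_mul fun z => conj z ^ k, hv.fourierT_vecL hF] at h2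
  exact ⟨h1, h2⟩

/-- The energy identity `(Pv, v)_s = -‖L̄v‖_s² - ‖z̄ᵏLv‖_s²`. -/
theorem IsTestFunction.innerS_opP (hv : IsTestFunction ε v) {F : ℂ → ℝ}
    (hF : ContDiff ℝ ∞ (Fz F)) (k : ℕ) (s : ℝ) :
    innerS s (DegenerateSquares.opP k F v) v =
      ((-(normS s (DegenerateSquares.vecLbar F v) ^ 2 +
        normS s (fun p => conj p.1 ^ k * DegenerateSquares.vecL F v p) ^ 2) : ℝ) : ℂ) := by
  obtain ⟨i1, i2⟩ := hv.integrable_energy hF k s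
  rw [innerS_eq (hv.opP hF k) hv, hv.normS_vecLbar_sq hF, hv.normS_conj_pow_vecL_sq hF,
    ← integral_add i1 i2, ← integral_neg, ← integral_complex_ofReal]
  congr 1
  funext τ
  simp only [hv.fourierT_opP hF]
  rw [integral_slice_op hF (hv.contDiff_fourierT τ) (hv.hasCompactSupport_fourierT τ)]
  push_cast
  ring

end

/-! ### From the scale `δ` to Sobolev weights. -/

/-- Both signs of `κ` are needed: the loss `(k-1)/(2m)` is a gain when `k = 0`, and then `1 + y² ≤
2y²` costs the constant. -/
theorem one_add_sq_rpow_neg_le {y : ℝ} (hy : 1 ≤ y) (κ : ℝ) :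
    (1 + y ^ 2) ^ (-κ) ≤ 2 ^ |κ| * (y ^ 2) ^ (-κ) := by
  have hy2 : 1 ≤ y ^ 2 := one_le_pow₀ hy
  rcases le_or_gt 0 κ with hκ | hκ
  · refine (Real.rpow_le_rpow_of_nonpos (by positivity) (by linarith : y ^ 2 ≤ 1 + y ^ 2)
      (by linarith)).trans (le_mul_of_one_le_left (by positivity) ?_)
    exact Real.one_le_rpow one_le_two (abs_nonneg _)
  · rw [abs_of_neg hκ, ← Real.mul_rpow (by norm_num) (by positivity)]
    exact Real.rpow_le_rpow (by positivity) (by linarith) (by linarith)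

/-- A bound at scale `δ = |σ| ^ (-1 / (2 m))`, rewritten with the weight `1 + σ²`. -/
theorem weight_mul_le_of_scale {m k : ℕ} (hm : 1 ≤ m) {σ X D : ℝ} (hσ : 1 ≤ |σ|) (hX : 0 ≤ X)
    (h : ∀ δ : ℝ, 0 < δ → δ ≤ 1 → |σ| * δ ^ (2 * m) = 1 → δ ^ (2 * k) * X ≤ δ ^ 2 * D) :
    (1 + σ ^ 2) ^ (-(((k : ℝ) - 1) / (2 * m))) * X ≤ 2 ^ |((k : ℝ) - 1) / (2 * m)| * D := by
  have hσ0 : 0 < |σ| := by linarith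
  have hm0 : (0 : ℝ) < m := by exact_mod_cast hm
  set κ := ((k : ℝ) - 1) / (2 * m) with hκ
  set δ : ℝ := |σ| ^ (-(1 / (2 * m)) : ℝ) with hδ
  have hδ0 : 0 < δ := by positivity
  have h1 := h δ hδ0 (Real.rpow_le_one_of_one_le_of_nonpos hσ
    (neg_nonpos.2 (by positivity))) (by
      rw [hδ, ← Real.rpow_mul_natCast hσ0.le]
      have : (-(1 / (2 * m)) : ℝ) * ((2 * m : ℕ) : ℝ) = -1 := by push_cast; field_simp
      rw [this, Real.rpow_neg_one, mul_inv_cancel₀ hσ0.ne'])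
  -- Exponents of `|σ|`: `-k/m = -(k-1)/m - 1/m`, and `2κ = (k-1)/m`.
  have h2 : δ ^ (2 * k) = (|σ| ^ 2) ^ (-κ) * δ ^ 2 := by
    rw [hδ, ← Real.rpow_mul_natCast hσ0.le, ← Real.rpow_mul_natCast hσ0.le,
      ← Real.rpow_natCast |σ| 2, ← Real.rpow_mul hσ0.le, ← Real.rpow_add hσ0]
    congr 1
    rw [hκ]
    push_cast
    field_simp
    ring
  have h3 : (|σ| ^ 2) ^ (-κ) * X ≤ D := by
    rw [h2] at h1
    refine le_of_mul_le_mul_left ?_ (show 0 < δ ^ 2 by positivity)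
    linarith
  have h4 := one_add_sq_rpow_neg_le hσ κ
  rw [sq_abs] at h3 h4
  calc (1 + σ ^ 2) ^ (-κ) * X ≤ (2 ^ |κ| * (σ ^ 2) ^ (-κ)) * X :=
        mul_le_mul_of_nonneg_right h4 hX
    _ = 2 ^ |κ| * ((σ ^ 2) ^ (-κ) * X) := by ring
    _ ≤ _ := mul_le_mul_of_nonneg_left h3 (by positivity)

/-! ### Localization near the origin. -/

/-- A function smooth near `0` agrees near `0` with a globally smooth function. -/
theorem exists_contDiff_eqOn_ball {U : Set ℂ} (hU : IsOpen U) (h0 : (0 : ℂ) ∈ U) {F : ℂ → ℝ}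
    (hF : ContDiffOn ℝ ∞ F U) : ∃ ρ : ℝ, 0 < ρ ∧ Metric.ball (0 : ℂ) ρ ⊆ U ∧
      ∃ G : ℂ → ℝ, ContDiff ℝ ∞ G ∧ Set.EqOn G F (Metric.ball 0 ρ) := by
  obtain ⟨R, hR, hRU⟩ := Metric.isOpen_iff.1 hU 0 h0
  let β : ContDiffBump (0 : ℂ) := ⟨R / 4, R / 2, by positivity, by linarith⟩
  have hβU : tsupport β ⊆ U := by
    rw [β.tsupport_eq]
    exact (Metric.closedBall_subset_ball (show R / 2 < R by linarith)).trans hRU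
  refine ⟨R / 4, by positivity, (Metric.ball_subset_ball (by linarith)).trans hRU,
    fun z => β z * F z, contDiff_iff_contDiffAt.2 fun z => ?_, fun z hz => ?_⟩
  · by_cases hz : z ∈ tsupport β
    · exact β.contDiff.contDiffAt.mul (hF.contDiffAt (hU.mem_nhds (hβU hz)))
    · refine (contDiffAt_const (c := (0 : ℝ))).congr_of_eventuallyEq ?_
      filter_upwards [(isClosed_tsupport β).isOpen_compl.mem_nhds hz] with y hy
      rw [image_eq_zero_of_notMem_tsupport hy, zero_mul]
  · change β z * F z = F z
    rw [β.one_of_mem_closedBall (Metric.ball_subset_closedBall hz), one_mul]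

theorem dz_congr {f g : ℂ → ℂ} {z : ℂ} (h : f =ᶠ[nhds z] g) : dz f z = dz g z := by
  simp only [dz, h.fderiv_eq]

theorem dzbar_congr {f g : ℂ → ℂ} {z : ℂ} (h : f =ᶠ[nhds z] g) : dzbar f z = dzbar g z := by
  simp only [dzbar, h.fderiv_eq]

theorem Fz_eqOn {F G : ℂ → ℝ} {V : Set ℂ} (hV : IsOpen V) (h : Set.EqOn G F V) :
    Set.EqOn (Fz G) (Fz F) V := fun z hz =>
  dz_congr (by filter_upwards [hV.mem_nhds hz] with y hy; rw [h hy])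

theorem contDiff_Fz {G : ℂ → ℝ} (hG : ContDiff ℝ ∞ G) : ContDiff ℝ ∞ (Fz G) :=
  contDiff_dz (Complex.ofRealCLM.contDiff.comp hG)

/-- Where the coefficients may differ, `∂_t v` vanishes; so `F` may be replaced by a globally smooth
function. -/
theorem IsTestFunction.vecL_congr {ε : ℝ} {v : ℂ × ℝ → ℂ} (hv : IsTestFunction ε v)
    {F G : ℂ → ℝ} (h : ∀ z : ℂ, ‖z‖ < ε → Fz G z = Fz F z) :
    DegenerateSquares.vecL F v = DegenerateSquares.vecL G v := by
  funext p
  rw [vecL_eq hv.differentiable, vecL_eq hv.differentiable]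
  by_cases hp : ‖p.1‖ < ε
  · rw [h _ hp]
  · simp [(hv.fderiv_apply (0, 1)).eq_zero hp]

theorem IsTestFunction.vecLbar_congr {ε : ℝ} {v : ℂ × ℝ → ℂ} (hv : IsTestFunction ε v)
    {F G : ℂ → ℝ} (h : ∀ z : ℂ, ‖z‖ < ε → Fz G z = Fz F z) :
    DegenerateSquares.vecLbar F v = DegenerateSquares.vecLbar G v := by
  funext p
  rw [vecLbar_eq hv.differentiable, vecLbar_eq hv.differentiable]
  by_cases hp : ‖p.1‖ < ε
  · rw [h _ hp]
  · simp [(hv.fderiv_apply (0, 1)).eq_zero hp]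

theorem IsTestFunction.opP_congr {ε : ℝ} {v : ℂ × ℝ → ℂ} (hv : IsTestFunction ε v)
    {F G : ℂ → ℝ} (hG : ContDiff ℝ ∞ (Fz G)) (h : ∀ z : ℂ, ‖z‖ < ε → Fz G z = Fz F z) (k : ℕ) :
    DegenerateSquares.opP k F v = DegenerateSquares.opP k G v := by
  funext p
  rw [DegenerateSquares.opP, DegenerateSquares.opP, hv.vecL_congr h, hv.vecLbar_congr h,
    (hv.vecLbar hG).vecL_congr h,
    ((hv.vecL hG).fst_mul (contDiff_norm_pow_ofReal k)).vecLbar_congr h]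

/-- Supplies the fixed sign and the two-sided bounds on the commutator that the one-frequency
estimate requires. -/
theorem exists_sign_bounds {g : ℂ → ℝ} (hg : ContinuousAt g 0) (hg0 : g 0 ≠ 0) :
    ∃ s₀ : ℝ, (s₀ = 1 ∨ s₀ = -1) ∧ ∃ ρ : ℝ, 0 < ρ ∧ ∀ z : ℂ, ‖z‖ < ρ →
      |g 0| / 2 ≤ s₀ * g z ∧ |g z| ≤ 2 * |g 0| := by
  have hpos : 0 < |g 0| := abs_pos.2 hg0
  obtain ⟨ρ, hρ, h⟩ := Metric.continuousAt_iff.1 hg (|g 0| / 2) (by positivity)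
  have hd : ∀ z : ℂ, ‖z‖ < ρ → |g z - g 0| < |g 0| / 2 := fun z hz => by
    simpa [Real.dist_eq] using h (by simpa using hz)
  rcases lt_or_gt_of_ne hg0 with hneg | hp
  · refine ⟨-1, Or.inr rfl, ρ, hρ, fun z hz => ?_⟩
    have h1 := abs_lt.1 (hd z hz)
    rw [abs_of_neg hneg] at *
    exact ⟨by linarith, abs_le.2 ⟨by linarith, by linarith⟩⟩
  · refine ⟨1, Or.inl rfl, ρ, hρ, fun z hz => ?_⟩
    have h1 := abs_lt.1 (hd z hz)
    rw [abs_of_pos hp] at *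
    exact ⟨by linarith, abs_le.2 ⟨by linarith, by linarith⟩⟩

/-! ### Assembling the frequencies. -/

/-- The weighted inequality at every frequency: high frequencies are controlled by the energy
and low frequencies by the error term. -/
theorem weighted_frequency_le {κ C₀ S s N σ X E : ℝ} (hS : |s| ≤ S) (hX : 0 ≤ X) (hE : 0 ≤ E)
    (hC₀ : 0 ≤ C₀) (h : 1 ≤ |σ| → (1 + σ ^ 2) ^ (-κ) * X ≤ C₀ * E) :
    (1 + σ ^ 2) ^ (s - κ) * X ≤ C₀ * ((1 + σ ^ 2) ^ s * E) +
      2 ^ (S + |κ| + |N|) * ((1 + σ ^ 2) ^ (-N) * X) := by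
  set x := 1 + σ ^ 2 with hx
  have hx1 : 1 ≤ x := by rw [hx]; nlinarith [sq_nonneg σ]
  have hx0 : 0 < x := by linarith
  rcases le_or_gt 1 |σ| with hσ | hσ
  · have h1 := mul_le_mul_of_nonneg_left (h hσ) (show 0 ≤ x ^ s by positivity)
    have h2 : 0 ≤ (2 : ℝ) ^ (S + |κ| + |N|) * (x ^ (-N) * X) := by positivity
    rw [sub_eq_add_neg, Real.rpow_add hx0]
    linarith
  · have hx2 : x ≤ 2 := by
      have := (sq_lt_one_iff_abs_lt_one σ).2 hσ
      linarith
    -- At low frequency `1 ≤ x ≤ 2`, so all powers of `x` are comparable, uniformly for `|s| ≤ S`.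
    have h1 : x ^ (s - κ) ≤ 2 ^ (S + |κ| + |N|) * x ^ (-N) := by
      have e : s - κ = (s - κ + N) + -N := by ring
      rw [e, Real.rpow_add hx0]
      refine mul_le_mul_of_nonneg_right ?_ (by positivity)
      have h3 : s - κ + N ≤ S + |κ| + |N| := by
        linarith [le_abs_self s, neg_abs_le κ, le_abs_self N]
      have h4 : 0 ≤ S + |κ| + |N| := by
        linarith [abs_nonneg s, abs_nonneg κ, abs_nonneg N]
      exact (Real.rpow_le_rpow_of_exponent_le hx1 h3).trans (Real.rpow_le_rpow hx0.le hx2 h4)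
    have h2 := mul_le_mul_of_nonneg_right h1 hX
    have h3 : 0 ≤ C₀ * (x ^ s * E) := by positivity
    linarith

end DegenerateSquares

theorem proposition1p1 (m k : ℕ) (hm : 1 ≤ m)
    (U : Set ℂ) (hU : IsOpen U) (h0 : (0 : ℂ) ∈ U)
    (F g : ℂ → ℝ) (h : ℂ → ℂ) (hF : ContDiffOn ℝ ∞ F U)
    (hg : ContinuousAt g 0) (hg0 : g 0 ≠ 0) (hh : ContinuousAt h 0)
    (hFzzbar : ∀ z ∈ U, Fzzbar F z = ((‖z‖ ^ (2 * (m - 1)) * g z : ℝ) : ℂ))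
    (hFz : ∀ z ∈ U, Fz F z = conj z * ((‖z‖ ^ (2 * (m - 1)) : ℝ) : ℂ) * h z) :
    ∃ ε : ℝ, 0 < ε ∧ Metric.ball (0 : ℂ) ε ⊆ U ∧
      ∀ K : Set ℝ, IsCompact K →
        ∃ C : ℝ, ∀ N : ℝ, ∃ C' : ℝ, ∀ s ∈ K, ∀ v : ℂ × ℝ → ℂ,
          ContDiff ℝ ∞ v → HasCompactSupport v → tsupport v ⊆ {p | ‖p.1‖ < ε} →
            normS (s - ((k : ℝ) - 1) / (2 * (m : ℝ))) v ^ 2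
                + normS s (vecLbar F v) ^ 2
                + normS s (fun p => conj p.1 ^ k * vecL F v p) ^ 2
              ≤ C * ‖innerS s (opP k F v) v‖ + C' * normS (-N) v ^ 2 := by
  open MeasureTheory in
  obtain ⟨ρ₁, hρ₁, hρU, G, hG, hGF⟩ := exists_contDiff_eqOn_ball hU h0 hF
  obtain ⟨s₀, hs₀, ρ₂, hρ₂, hgb⟩ := exists_sign_bounds hg hg0
  obtain ⟨C₀, hC₀, hslice⟩ := exists_slice_estimate (m := m) (k := k) hm
    (c₀ := |g 0| / 2) (c₁ := 2 * |g 0|) (by positivity) (by positivity)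
  -- The bound `1` serves the comparison of weights, `ρ₁` is where `G = F`, and `ρ₂` is where `g`
  -- stays close to `g 0`.
  set ε := min 1 (min ρ₁ ρ₂) with hε
  have hε1 : ε ≤ 1 := min_le_left _ _
  have hε2 : ε ≤ ρ₁ := (min_le_right _ _).trans (min_le_left _ _)
  have hε3 : ε ≤ ρ₂ := (min_le_right _ _).trans (min_le_right _ _)
  have hFzG := Fz_eqOn Metric.isOpen_ball hGF
  have hFzε : ∀ z : ℂ, ‖z‖ < ε → Fz G z = Fz F z := fun z hz =>
    hFzG (by simpa using hz.trans_le hε2)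
  have hGs := contDiff_Fz hG
  have hlevi : ∀ z : ℂ, ‖z‖ < ε →
      dzbar (Fz G) z = ((‖z‖ ^ (2 * (m - 1)) * g z : ℝ) : ℂ) := by
    intro z hz
    have hzb : z ∈ Metric.ball (0 : ℂ) ρ₁ := by simpa using hz.trans_le hε2
    rw [← hFzzbar z (hρU hzb)]
    exact dzbar_congr (hFzG.eventuallyEq_of_mem (Metric.isOpen_ball.mem_nhds hzb))
  refine ⟨ε, by positivity, (Metric.ball_subset_ball hε2).trans hρU, fun K hK => ?_⟩
  obtain ⟨S, hS⟩ := hK.isBounded.exists_norm_le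
  set κ := ((k : ℝ) - 1) / (2 * (m : ℝ)) with hκ
  -- The `+ 1` pays for the two energies on the left. Only the error constant depends on `K` and
  -- `N`.
  refine ⟨2 ^ |κ| * C₀ + 1, fun N => ⟨2 ^ (S + |κ| + |N|), fun s hs v hv1 hv2 hv3 => ?_⟩⟩
  have hv : IsTestFunction ε v := ⟨hv1, hv2, hv3⟩
  -- After this rewriting `|(Pv, v)_s|` is exactly the sum of the two energies.
  rw [hv.vecL_congr hFzε, hv.vecLbar_congr hFzε, hv.opP_congr hGs hFzε, hv.innerS_opP hGs,
    Complex.norm_real, norm_neg, Real.norm_of_nonneg (by positivity)]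
  have main : normS (s - κ) v ^ 2 ≤ 2 ^ |κ| * C₀ * (normS s (vecLbar G v) ^ 2 +
      normS s (fun p => conj p.1 ^ k * vecL G v p) ^ 2) +
      2 ^ (S + |κ| + |N|) * normS (-N) v ^ 2 := by
    obtain ⟨i1, i2⟩ := hv.integrable_energy hGs k s
    have i12 := i1.add i2
    simp only [Pi.add_def] at i12
    have i3 := integrable_weight_slice hv (-N)
    rw [normS_sq_eq hv, normS_sq_eq hv, hv.normS_vecLbar_sq hGs, hv.normS_conj_pow_vecL_sq hGs,
      ← integral_add i1 i2, ← integral_const_mul, ← integral_const_mul,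
      ← integral_add (i12.const_mul _) (i3.const_mul _)]
    refine integral_mono (integrable_weight_slice hv (s - κ))
      ((i12.const_mul _).add (i3.const_mul _)) fun τ => ?_
    have hsupp : ∀ z ∈ tsupport (fun z => fourierT v (z, τ)), ‖z‖ < ε := fun z hz =>
      hv.norm_lt_of_mem_tsupport_fourierT hz
    have hX : 0 ≤ ∫ z, ‖fourierT v (z, τ)‖ ^ 2 := integral_nonneg fun z => by positivity
    have hE : 0 ≤ (∫ z, ‖sliceLbar (Fz G) (2 * Real.pi * τ) (fun z => fourierT v (z, τ)) z‖ ^ 2) +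
        ∫ z, ‖conj z ^ k * sliceL (Fz G) (2 * Real.pi * τ) (fun z => fourierT v (z, τ)) z‖ ^ 2 :=
      add_nonneg (integral_nonneg fun z => by positivity) (integral_nonneg fun z => by positivity)
    have := weighted_frequency_le (κ := κ) (C₀ := 2 ^ |κ| * C₀) (N := N) (σ := 2 * Real.pi * τ)
      (hS s hs) hX hE (by positivity) fun hσ => by
        rw [mul_assoc ((2 : ℝ) ^ |κ|)]
        refine weight_mul_le_of_scale hm hσ hX fun δ hδ0 hδ1 hδ => ?_
        have := hslice s₀ (Fz G) (fun z => fourierT v (z, τ))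
          (fun z => ‖z‖ ^ (2 * (m - 1)) * g z) hs₀ hGs (hv.contDiff_fourierT τ)
          (hv.hasCompactSupport_fourierT τ) (fun z hz => (hsupp z hz).le.trans hε1)
          (fun z hz => hlevi z (hsupp z hz)) (fun z hz => ?_) (fun z hz => ?_) _ δ hδ0 hδ1 hδ
        · linarith
        · have h1 := (hgb z ((hsupp z hz).trans_le hε3)).1
          have h2 := mul_le_mul_of_nonneg_right h1
            (show 0 ≤ ‖z‖ ^ (2 * (m - 1)) by positivity)
          linarith
        · rw [abs_mul, abs_of_nonneg (show 0 ≤ ‖z‖ ^ (2 * (m - 1)) by positivity), mul_comm]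
          exact mul_le_mul_of_nonneg_right (hgb z ((hsupp z hz).trans_le hε3)).2 (by positivity)
    simpa only [mul_add] using this
  linarith
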